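/- Let $n,k\ge 1$ be integers and let $w\in S_n$ be a permutation of $[n]=\{1,\dots,n\}$. **Definitions.** For $X=\{x_1<\dots<x_m\}\subseteq[n]$ put $X_i=X\setminus\{x_i\}$ and let $P(X)=\{X_1,\dots,X_m\}$ be its packet. The lex order on $P(X)$ is $(X_m,\dots,X_1)$ and the antilex order is $(X_1,\dots,X_m)$. A prefix of $P(X)$ is a (possibly empty) set $\{X_m,X_{m-1},\dots,X_i\}$, and a suffix is a (possibly empty) set $\{X_i,\dots,X_1\}$. For $j\ge 0$, let $\mathrm{Inv}_j(w)$ be the set of $j$-subsets $\{x_1<\dots<x_j\}$ of $[n]$ with $w^{-1}(x_1)>\dots>w^{-1}(x_j)$. A set $X=\{x_1<\dots<x_m\}$ is a quasi-inversion of $w$ if exactly one of its pairs $\{x_i,x_j\}$ is not in $\mathrm{Inv}_2(w)$. For $j\geq 1$, let $\le_{P_w(n,j)}$ be the reflexive transitive closure of the following relations on $\mathrm{Inv}_j(w)$: if $X$ is a quasi-inversion of $w$ with $|X|=j+1$ and $P(X)\cap\mathrm{Inv}_j(w)=\{X_i,X_{i+1}\}$, where $1\le i\le j$, then $X_i<X_{i+1}$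 if $j-i$ is odd, and $X_{i+1}<X_i$ if $j-i$ is even. Let $\mathcal A_w(n,j)$ be the set of $j$-admissible orders: total orders $\rho$ of $\mathrm{Inv}_j(w)$ that extend $\le_{P_w(n,j)}$ and whose restriction to $P(X)$ is the lex or the antilex order for every $X\in\mathrm{Inv}_{j+1}(w)$. The reversal set $\mathrm{Rev}(\rho)$ is the set of all $X\in\mathrm{Inv}_{j+1}(w)$ for which $\rho|_{P(X)}$ is the antilex order. Two elements of $\mathrm{Inv}_j(w)$ commute if they are incomparable for $\le_{P_w(n,j)}$ and do not both lie in $P(Z)$ for any $(j+1)$-subset $Z$ of $[n]$. A commutation exchanges two adjacent commuting elements of a total order. A lex-to-antilex packet flip of a total order reverses the packet $P(X)$ of some $X\in\mathrm{Inv}_{j+1}(w)$ whose elements occur consecutively and in lex order. Let $\mathcal B_w(n,j)$ be the set of classes $[\rho]$ of $\rho\in\mathcal A_w(n,j)$ under commutations, with $[\rho]\le[\sigma]$ if $\sigma$ can be obtained from $\rho$ by a sequence of commutations and lex-to-antilex packet flips. A set $R\subseteq\mathrm{Inv}_j(w)$ is consistent if it is a lower order ideal for $\le_{P_w(n,j)}$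 and $P(X)\cap R$ is a prefix or a suffix of $P(X)$ for every $X\in\mathrm{Inv}_{j+1}(w)$. Let $\mathcal C_w(n,j)$ be the set of consistent sets, partially ordered by the reflexive transitive closure of single step inclusion: $R\le S$ if there are consistent sets $R=R_0\subset R_1\subset\dots\subset R_m=S$ with $|R_{i}\setminus R_{i-1}|=1$ for all $i$. **Theorem.** (a) $\mathcal B_w(n,k)$ is a partially ordered set, and $[\rho]\mapsto\mathrm{Rev}(\rho)$ is a well-defined isomorphism of posets $\mathcal B_w(n,k)\to\mathcal C_w(n,k+1)$. (b) The posets $\mathcal B_w(n,k)\cong\mathcal C_w(n,k+1)$ are ranked, where $R\in\mathcal C_w(n,k+1)$ has rank $|R|$ and $[\rho]\in\mathcal B_w(n,k)$ has rank $|\mathrm{Rev}(\rho)|$. Each has a unique minimal element, which is its minimum and corresponds to the reversal set $\emptyset$, and a unique maximal element, which is its maximum and corresponds to the reversal set $\mathrm{Inv}_{k+1}(w)$. (c) Let $N=|\mathrm{Inv}_{k+1}(w)|$. Every maximal chain of $\mathcal C_w(n,k+1)$ has the form $\emptyset=R_0\lessdot R_1\lessdot\dots\lessdot R_N$, where each $R_i\setminus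 R_{i-1}$ consists of a single element, and mapping such a chain to the sequence of these elements $$(R_1\setminus R_0,\ R_2\setminus R_1,\ \dots,\ R_N\setminus R_{N-1})$$ is a bijection from the set of maximal chains of $\mathcal C_w(n,k+1)$ onto $\mathcal A_w(n,k+1)$. -/

import Mathlib

/-! Higher Bruhat orders for a permutation `w` of `Fin n`.  Throughout, an ordered subset
`[x₁ < ⋯ < x_k]` is the finset of its entries, the one-line notation of `w` is
`(w 1, …, w n)`, and a total order on a finite set is the list of the elements of the set
in increasing order. -/

namespace HigherBruhat

variable {n : ℕ}

/-- The `k`-inversions of `w`: the sets `x₁ < ⋯ < x_k` with `w⁻¹ x₁ > ⋯ > w⁻¹ x_k`. -/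
def Inv (w : Equiv.Perm (Fin n)) (k : ℕ) : Finset (Finset (Fin n)) :=
  (Finset.univ.powersetCard k).filter fun X =>
    ∀ x ∈ X, ∀ y ∈ X, x < y → w⁻¹ y < w⁻¹ x

/-- `face X i` is `X_i`: the set `X` with its `i`-th smallest element removed (`1 ≤ i ≤ #X`). -/
def face (X : Finset (Fin n)) (i : ℕ) : Finset (Fin n) :=
  X.filter fun x => (X.filter fun y => y ≤ x).card ≠ i

/-- The packet `P(X) = {X_1, …, X_k}`, where `k = #X`. -/
def packet (X : Finset (Fin n)) : Finset (Finset (Fin n)) :=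
  (Finset.Icc 1 X.card).image (face X)

/-- The antilexicographic order `(X_1, X_2, …, X_k)` on `P(X)`. -/
def antilex (X : Finset (Fin n)) : List (Finset (Fin n)) :=
  (List.range' 1 X.card).map (face X)

/-- The lexicographic order `(X_k, …, X_2, X_1)` on `P(X)`. -/
def lex (X : Finset (Fin n)) : List (Finset (Fin n)) :=
  (antilex X).reverse

/-- `S = {X_k, X_{k-1}, …, X_i}` for some `i`; the empty set is allowed (`i = k + 1`). -/
def IsPrefixOf (X : Finset (Fin n)) (S : Finset (Finset (Fin n))) : Prop :=
  ∃ i, 1 ≤ i ∧ i ≤ X.card + 1 ∧ S = (Finset.Icc i X.card).image (face X)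

/-- `S = {X_i, X_{i-1}, …, X_1}` for some `i`; the empty set is allowed (`i = 0`). -/
def IsSuffixOf (X : Finset (Fin n)) (S : Finset (Finset (Fin n))) : Prop :=
  ∃ i, i ≤ X.card ∧ S = (Finset.Icc 1 i).image (face X)

/-- `X` is a quasi-inversion of `w`: all but exactly one of the pairs of elements of `X`
are inversions of `w`. -/
def IsQuasiInversion (w : Equiv.Perm (Fin n)) (X : Finset (Fin n)) : Prop :=
  ((X ×ˢ X).filter fun p => p.1 < p.2 ∧ ¬ w⁻¹ p.2 < w⁻¹ p.1).card = 1

/-- The quasi-inversion relations `A < B` generating the permanent poset on `Inv w k`. -/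
def QuasiRel (w : Equiv.Perm (Fin n)) (k : ℕ) (A B : Finset (Fin n)) : Prop :=
  ∃ X : Finset (Fin n), X.card = k + 1 ∧ IsQuasiInversion w X ∧
    ∃ i, 1 ≤ i ∧ i ≤ k ∧ packet X ∩ Inv w k = {face X i, face X (i + 1)} ∧
      ((Odd (k - i) ∧ A = face X i ∧ B = face X (i + 1)) ∨
       (Even (k - i) ∧ A = face X (i + 1) ∧ B = face X i))

/-- The order relation of the permanent poset on `Inv w k`: the reflexive transitive closure
of the quasi-inversion relations. -/
def PermLE (w : Equiv.Perm (Fin n)) (k : ℕ) : Finset (Fin n) → Finset (Fin n) → Prop :=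
  Relation.ReflTransGen (QuasiRel w k)

/-- `ρ` is a `k`-admissible order for `w`. -/
structure IsAdmissible (w : Equiv.Perm (Fin n)) (k : ℕ) (ρ : List (Finset (Fin n))) : Prop where
  /-- `ρ` lists every element of `Inv w k` exactly once, i.e. is a total order of `Inv w k`. -/
  nodup : ρ.Nodup
  mem_iff : ∀ X, X ∈ ρ ↔ X ∈ Inv w k
  /-- `ρ` is a linear extension of the permanent poset. -/
  linearExtension : ∀ X ∈ Inv w k, ∀ Y ∈ Inv w k, PermLE w k X Y → ρ.idxOf X ≤ ρ.idxOf Y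
  /-- The restriction of `ρ` to the packet of each `(k+1)`-inversion is lex or antilex. -/
  restrict : ∀ X ∈ Inv w (k + 1),
    ρ.filter (fun Y => Y ∈ packet X) = lex X ∨ ρ.filter (fun Y => Y ∈ packet X) = antilex X

/-- The set `𝒜_w(n,k)` of `k`-admissible orders. -/
def AdmissibleOrder (w : Equiv.Perm (Fin n)) (k : ℕ) : Type :=
  {ρ : List (Finset (Fin n)) // IsAdmissible w k ρ}

/-- The reversal set of a total order: the `(k+1)`-inversions whose packet is in antilex order. -/
def Rev (w : Equiv.Perm (Fin n)) (k : ℕ) (ρ : List (Finset (Fin n))) : Finset (Finset (Fin n)) :=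
  (Inv w (k + 1)).filter fun X => ρ.filter (fun Y => Y ∈ packet X) = antilex X

/-- `X` and `Y` commute with respect to `w`: they are incomparable in the permanent poset and
do not belong to a common packet. -/
def Commute (w : Equiv.Perm (Fin n)) (k : ℕ) (X Y : Finset (Fin n)) : Prop :=
  ¬ PermLE w k X Y ∧ ¬ PermLE w k Y X ∧
    ¬ ∃ Z : Finset (Fin n), Z.card = k + 1 ∧ X ∈ packet Z ∧ Y ∈ packet Z

/-- `σ` arises from `ρ` by exchanging two adjacent commuting elements. -/
def CommStep (w : Equiv.Perm (Fin n)) (k : ℕ) (ρ σ : List (Finset (Fin n))) : Prop :=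
  ∃ (a b : List (Finset (Fin n))) (X Y : Finset (Fin n)), Commute w k X Y ∧
    ρ = a ++ [X, Y] ++ b ∧ σ = a ++ [Y, X] ++ b

/-- `σ` arises from `ρ` by a lex-to-antilex packet flip. -/
def FlipStep (w : Equiv.Perm (Fin n)) (k : ℕ) (ρ σ : List (Finset (Fin n))) : Prop :=
  ∃ (a b : List (Finset (Fin n))), ∃ X ∈ Inv w (k + 1),
    ρ = a ++ lex X ++ b ∧ σ = a ++ antilex X ++ b

/-- `σ` is obtained from `ρ` by a sequence of commutations. -/
def CommEquiv (w : Equiv.Perm (Fin n)) (k : ℕ) :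
    List (Finset (Fin n)) → List (Finset (Fin n)) → Prop :=
  Relation.ReflTransGen (CommStep w k)

/-- `σ` is obtained from `ρ` by a sequence of commutations and lex-to-antilex packet flips. -/
def Reach (w : Equiv.Perm (Fin n)) (k : ℕ) :
    List (Finset (Fin n)) → List (Finset (Fin n)) → Prop :=
  Relation.ReflTransGen fun ρ σ => CommStep w k ρ σ ∨ FlipStep w k ρ σ

theorem CommStep.symm {w : Equiv.Perm (Fin n)} {k : ℕ} {ρ σ : List (Finset (Fin n))}
    (h : CommStep w k ρ σ) : CommStep w k σ ρ := by
  obtain ⟨a, b, X, Y, ⟨h1, h2, h3⟩, hρ, hσ⟩ := h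
  exact ⟨a, b, Y, X, ⟨h2, h1, fun ⟨Z, hZ, hY, hX⟩ => h3 ⟨Z, hZ, hX, hY⟩⟩, hσ, hρ⟩

theorem CommEquiv.symm {w : Equiv.Perm (Fin n)} {k : ℕ} {ρ σ : List (Finset (Fin n))}
    (h : CommEquiv w k ρ σ) : CommEquiv w k σ ρ := by
  induction (show Relation.ReflTransGen (CommStep w k) ρ σ from h) with
  | refl => exact Relation.ReflTransGen.refl
  | tail h₁ h₂ ih => exact Relation.ReflTransGen.head h₂.symm (ih h₁)

theorem CommEquiv.reach {w : Equiv.Perm (Fin n)} {k : ℕ} {ρ σ : List (Finset (Fin n))}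
    (h : CommEquiv w k ρ σ) : Reach w k ρ σ := by
  induction (show Relation.ReflTransGen (CommStep w k) ρ σ from h) with
  | refl => exact Relation.ReflTransGen.refl
  | tail h₁ h₂ ih => exact Relation.ReflTransGen.tail (ih h₁) (Or.inl h₂)

/-- Commutation equivalence on `𝒜_w(n,k)`. -/
def commSetoid (w : Equiv.Perm (Fin n)) (k : ℕ) : Setoid (AdmissibleOrder w k) where
  r ρ σ := CommEquiv w k ρ.1 σ.1
  iseqv := ⟨fun _ => Relation.ReflTransGen.refl, CommEquiv.symm, Relation.ReflTransGen.trans⟩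

/-- The `k`-th higher Bruhat order `ℬ_w(n,k)`: commutation classes of admissible orders. -/
def BruhatOrder (w : Equiv.Perm (Fin n)) (k : ℕ) : Type :=
  Quotient (commSetoid w k)

/-- The commutation class `[ρ]`. -/
def cls (w : Equiv.Perm (Fin n)) (k : ℕ) (ρ : AdmissibleOrder w k) : BruhatOrder w k :=
  Quotient.mk (commSetoid w k) ρ

/-- `[ρ] ≤ [σ]` if `σ` is obtained from `ρ` by commutations and lex-to-antilex packet flips. -/
instance (w : Equiv.Perm (Fin n)) (k : ℕ) : LE (BruhatOrder w k) where
  le := Quotient.lift₂ (fun ρ σ => Reach w k ρ.1 σ.1) fun _ _ _ _ h₁ h₂ => propext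
    ⟨fun h => (CommEquiv.reach (CommEquiv.symm h₁)).trans (h.trans (CommEquiv.reach h₂)),
     fun h => (CommEquiv.reach h₁).trans (h.trans (CommEquiv.reach (CommEquiv.symm h₂)))⟩

instance (w : Equiv.Perm (Fin n)) (k : ℕ) : Preorder (BruhatOrder w k) where
  le_refl a := Quotient.inductionOn a fun _ => Relation.ReflTransGen.refl
  le_trans a b c := Quotient.inductionOn₃ a b c fun _ _ _ => Relation.ReflTransGen.trans

/-- `R` is a consistent subset of `Inv w k`: an order ideal of the permanent poset satisfying
the Manin-Schechtman-Ziegler condition. -/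
structure IsConsistent (w : Equiv.Perm (Fin n)) (k : ℕ) (R : Finset (Finset (Fin n))) :
    Prop where
  subset : R ⊆ Inv w k
  ideal : ∀ X ∈ R, ∀ Y ∈ Inv w k, PermLE w k Y X → Y ∈ R
  msz : ∀ X ∈ Inv w (k + 1), IsPrefixOf X (packet X ∩ R) ∨ IsSuffixOf X (packet X ∩ R)

/-- The poset `𝒞_w(n,k)` of consistent subsets of `Inv w k`. -/
def ConsistentSet (w : Equiv.Perm (Fin n)) (k : ℕ) : Type :=
  {R : Finset (Finset (Fin n)) // IsConsistent w k R}

/-- Single step inclusion: `S` is `R` with one further element. -/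
def SingleStep (w : Equiv.Perm (Fin n)) (k : ℕ) (R S : ConsistentSet w k) : Prop :=
  ∃ X, X ∉ R.1 ∧ S.1 = insert X R.1

/-- The order on `𝒞_w(n,k)` is generated by single step inclusion. -/
instance (w : Equiv.Perm (Fin n)) (k : ℕ) : LE (ConsistentSet w k) where
  le := Relation.ReflTransGen (SingleStep w k)

theorem ConsistentSet.subset_of_le {w : Equiv.Perm (Fin n)} {k : ℕ} {R S : ConsistentSet w k}
    (h : R ≤ S) : R.1 ⊆ S.1 := by
  induction (show Relation.ReflTransGen (SingleStep w k) R S from h) with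
  | refl => exact Finset.Subset.refl _
  | tail h₁ h₂ ih =>
    obtain ⟨X, -, hX⟩ := h₂
    rw [hX]
    exact (ih h₁).trans (Finset.subset_insert _ _)

instance (w : Equiv.Perm (Fin n)) (k : ℕ) : PartialOrder (ConsistentSet w k) where
  le_refl _ := Relation.ReflTransGen.refl
  le_trans _ _ _ := Relation.ReflTransGen.trans
  le_antisymm _ _ h₁ h₂ := Subtype.ext
    (Finset.Subset.antisymm (ConsistentSet.subset_of_le h₁) (ConsistentSet.subset_of_le h₂))

end HigherBruhat

namespace HigherBruhat
variable {n : ℕ}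

/-! Two `k`-inversions `C ∪ {x}` and `C ∪ {y}` with `x < y` have as union either a `(k+1)`-inversion
or a quasi-inversion. A set `R` of `(k+1)`-inversions therefore orients every such pair (`Flipped`,
`Prec`): antilex or lex by membership in `R` when the union is an inversion, and by the parity of
the number of entries above `y` when it is a quasi-inversion, which is exactly the permanent
relation. An admissible order is the same thing as a linear extension of this relation for its own
reversal set (`IsAdmissible.isLinExt`, `IsLinExt.isAdmissible`), so the question is for which `R`
the relation is acyclic.

The answer is: for consistent `R`. If a linear extension exists, then for fixed `C` the order on the
entries `x` with `C ∪ {x}` an inversion is transitive on every triple `a < b < c`. For `k > 0` this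
local transitivity says precisely that `R` is consistent: triples with three inverted pairs give the
prefix-or-suffix condition, and triples with one non-inverted pair give either the ideal condition
or an automatic parity statement. Conversely, `exists_height_on` builds a height function from local
transitivity by deleting the largest entry `m`: the sets containing `m` form the same problem for `k
- 1`, and those avoiding `m` split into a lower part placed before them and an upper part placed
after them.

Linear extensions of one relation are connected by exchanges of incomparable neighbours, so
commutation classes correspond to consistent sets. A packet flip adds one element to `R`.
Conversely, if `R` and `R ∪ {X}` are both consistent, acyclicity of both relations makes the packet
of `X` convex, hence consecutive and in lex order in some linear extension for `R`
(`IsConsistent.exists_isLinExt_lex`). Thus reachability is single step inclusion.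

The height function also shows that a nonempty consistent set can lose an element and a proper one
can gain an element (`exists_erase`, `exists_insert`), which gives minimum, maximum and rank.
Finally, an order of the inversions is admissible exactly when all its initial segments are
consistent, and this is the bijection with maximal chains. -/

/-! ### Faces and packets in terms of erased entries -/

theorem mem_Inv {w : Equiv.Perm (Fin n)} {k : ℕ} {X : Finset (Fin n)} :
    X ∈ Inv w k ↔ X.card = k ∧ ∀ x ∈ X, ∀ y ∈ X, x < y → w⁻¹ y < w⁻¹ x := by
  simp [Inv, Finset.mem_powersetCard]

/-- The position of `x` in `X`, counted from `1`. -/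
def rk (X : Finset (Fin n)) (x : Fin n) : ℕ := (X.filter fun y => y ≤ x).card

theorem rk_lt_rk {X : Finset (Fin n)} {x y : Fin n} (hy : y ∈ X) (h : x < y) :
    rk X x < rk X y := by
  apply Finset.card_lt_card
  rw [Finset.ssubset_iff_of_subset]
  · exact ⟨y, by simp [hy], by simp [h]⟩
  · intro z hz
    simp only [Finset.mem_filter] at hz ⊢
    exact ⟨hz.1, hz.2.trans h.le⟩

theorem rk_injOn {X : Finset (Fin n)} {x y : Fin n} (hx : x ∈ X) (hy : y ∈ X)
    (h : rk X x = rk X y) : x = y := by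
  rcases lt_trichotomy x y with h1 | h1 | h1
  · exact absurd (rk_lt_rk hy h1) (by omega)
  · exact h1
  · exact absurd (rk_lt_rk hx h1) (by omega)

theorem face_rk {X : Finset (Fin n)} {x : Fin n} (hx : x ∈ X) : face X (rk X x) = X.erase x := by
  ext z
  simp only [face, Finset.mem_filter, Finset.mem_erase]
  constructor
  · rintro ⟨hz, h⟩
    exact ⟨fun e => h (by rw [e]; rfl), hz⟩
  · rintro ⟨h, hz⟩
    exact ⟨hz, fun e => h (rk_injOn hz hx e)⟩

theorem rk_mem_Icc {X : Finset (Fin n)} {x : Fin n} (hx : x ∈ X) :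
    rk X x ∈ Finset.Icc 1 X.card := by
  rw [Finset.mem_Icc]
  exact ⟨Finset.card_pos.2 ⟨x, by simp [hx]⟩, Finset.card_le_card (Finset.filter_subset _ _)⟩

theorem image_rk (X : Finset (Fin n)) : X.image (rk X) = Finset.Icc 1 X.card := by
  apply Finset.eq_of_subset_of_card_le
  · intro i hi
    obtain ⟨x, hx, rfl⟩ := Finset.mem_image.1 hi
    exact rk_mem_Icc hx
  · rw [Finset.card_image_of_injOn fun x hx y hy h => rk_injOn hx hy h]
    simp

theorem exists_rk_eq {X : Finset (Fin n)} {i : ℕ} (h1 : 1 ≤ i) (h2 : i ≤ X.card) :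
    ∃ x ∈ X, rk X x = i := by
  have : i ∈ X.image (rk X) := by rw [image_rk]; simp [h1, h2]
  simpa using this

theorem packet_eq (X : Finset (Fin n)) : packet X = X.image X.erase := by
  rw [packet, ← image_rk, Finset.image_image]
  exact Finset.image_congr fun x hx => face_rk hx

theorem mem_packet {X A : Finset (Fin n)} : A ∈ packet X ↔ ∃ x ∈ X, A = X.erase x := by
  rw [packet_eq]; simp [eq_comm]

theorem range'_eq_map_rk (X : Finset (Fin n)) :
    List.range' 1 X.card = (X.sort (· ≤ ·)).map (rk X) := by
  have h1 : ((X.sort (· ≤ ·)).map (rk X)).Pairwise (· < ·) := by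
    rw [List.pairwise_map]
    have := (Finset.sortedLT_sort X).pairwise
    refine List.Pairwise.imp_of_mem ?_ this
    intro a b _ hb hab
    exact rk_lt_rk ((Finset.mem_sort _).1 hb) hab
  refine List.Perm.eq_of_pairwise (le := (· < ·)) ?_ List.pairwise_lt_range' h1 ?_
  · intro a b _ _ h h'; omega
  · rw [List.perm_ext_iff_of_nodup (List.nodup_range') (h1.imp fun h => h.ne)]
    intro i
    have := congrArg (i ∈ ·) (image_rk X)
    simp only [Finset.mem_image, Finset.mem_Icc, eq_iff_iff] at this
    simp only [List.mem_range'_1, List.mem_map, Finset.mem_sort]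
    rw [this]; omega

theorem antilex_eq (X : Finset (Fin n)) : antilex X = (X.sort (· ≤ ·)).map X.erase := by
  rw [antilex, range'_eq_map_rk, List.map_map]
  apply List.map_congr_left
  intro x hx
  exact face_rk ((Finset.mem_sort _).1 hx)

theorem mem_antilex {X A : Finset (Fin n)} : A ∈ antilex X ↔ A ∈ packet X := by
  rw [antilex_eq, mem_packet]; simp [eq_comm]

theorem mem_lex {X A : Finset (Fin n)} : A ∈ lex X ↔ A ∈ packet X := by
  rw [lex, List.mem_reverse, mem_antilex]

theorem pairwise_antilex (X : Finset (Fin n)) :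
    (antilex X).Pairwise fun A B => ∃ x ∈ X, ∃ y ∈ X, x < y ∧ A = X.erase x ∧ B = X.erase y := by
  rw [antilex_eq, List.pairwise_map]
  refine List.Pairwise.imp_of_mem ?_ (Finset.sortedLT_sort X).pairwise
  intro a b ha hb hab
  exact ⟨a, (Finset.mem_sort _).1 ha, b, (Finset.mem_sort _).1 hb, hab, rfl, rfl⟩

theorem erase_ne_erase {X : Finset (Fin n)} {x y : Fin n} (hx : x ∈ X) (h : x ≠ y) :
    X.erase x ≠ X.erase y := by
  intro e
  have : x ∈ X.erase y := Finset.mem_erase.2 ⟨h, hx⟩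
  rw [← e] at this
  simp at this

theorem nodup_antilex (X : Finset (Fin n)) : (antilex X).Nodup := by
  refine (pairwise_antilex X).imp ?_
  rintro A B ⟨x, hx, y, hy, h, rfl, rfl⟩
  exact erase_ne_erase hx h.ne

theorem mem_Inv_of_subset {w : Equiv.Perm (Fin n)} {k j : ℕ} {X Y : Finset (Fin n)}
    (hX : X ∈ Inv w k) (h : Y ⊆ X) (hY : Y.card = j) : Y ∈ Inv w j :=
  mem_Inv.2 ⟨hY, fun x hx y hy => (mem_Inv.1 hX).2 x (h hx) y (h hy)⟩

theorem erase_mem_Inv {w : Equiv.Perm (Fin n)} {k : ℕ} {X : Finset (Fin n)} {x : Fin n}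
    (hX : X ∈ Inv w (k + 1)) (hx : x ∈ X) : X.erase x ∈ Inv w k :=
  mem_Inv_of_subset hX (Finset.erase_subset _ _)
    (by rw [Finset.card_erase_of_mem hx, (mem_Inv.1 hX).1]; rfl)

/-! ### Prefixes and suffixes of a packet -/

theorem isPrefixOf_iff {X : Finset (Fin n)} {R : Finset (Finset (Fin n))} :
    IsPrefixOf X (packet X ∩ R) ↔
      ∀ x ∈ X, ∀ y ∈ X, x < y → X.erase x ∈ R → X.erase y ∈ R := by
  constructor
  · rintro ⟨i, h1, h2, h⟩ x hx y hy hxy hR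
    have : X.erase x ∈ packet X ∩ R := Finset.mem_inter.2 ⟨mem_packet.2 ⟨x, hx, rfl⟩, hR⟩
    rw [h] at this
    obtain ⟨j, hj, e⟩ := Finset.mem_image.1 this
    rw [Finset.mem_Icc] at hj
    obtain ⟨z, hz, rfl⟩ := exists_rk_eq (h1.trans hj.1) hj.2
    rw [face_rk hz] at e
    have hzx : z = x := by
      by_contra hne; exact erase_ne_erase hz hne e
    subst hzx
    have : X.erase y ∈ packet X ∩ R := by
      rw [h, ← face_rk hy]
      exact Finset.mem_image_of_mem _ (Finset.mem_Icc.2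
        ⟨hj.1.trans (rk_lt_rk hy hxy).le, (Finset.mem_Icc.1 (rk_mem_Icc hy)).2⟩)
    exact (Finset.mem_inter.1 this).2
  · intro h
    by_cases hne : ∃ x ∈ X, X.erase x ∈ R
    · have hne' : (X.filter fun x => X.erase x ∈ R).Nonempty := by
        obtain ⟨x, hx, hxR⟩ := hne; exact ⟨x, by simp [hx, hxR]⟩
      obtain ⟨x, hx, hmin⟩ := Finset.exists_min_image _ id hne'
      simp only [Finset.mem_filter, id] at hx hmin
      have hr := Finset.mem_Icc.1 (rk_mem_Icc hx.1)
      refine ⟨rk X x, hr.1, by omega, ?_⟩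
      ext A
      simp only [Finset.mem_inter, Finset.mem_image, Finset.mem_Icc, mem_packet]
      constructor
      · rintro ⟨⟨y, hy, rfl⟩, hA⟩
        refine ⟨rk X y, ⟨?_, (Finset.mem_Icc.1 (rk_mem_Icc hy)).2⟩, face_rk hy⟩
        rcases (hmin y ⟨hy, hA⟩).eq_or_lt with e | e
        · rw [e]
        · exact (rk_lt_rk hy e).le
      · rintro ⟨j, ⟨hj, hj'⟩, rfl⟩
        obtain ⟨y, hy, rfl⟩ := exists_rk_eq (hr.1.trans hj) hj'
        rw [face_rk hy]
        refine ⟨⟨y, hy, rfl⟩, ?_⟩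
        rcases lt_trichotomy x y with e | e | e
        · exact h x hx.1 y hy e hx.2
        · rw [← e]; exact hx.2
        · exact absurd (rk_lt_rk hx.1 e) (by omega)
    · refine ⟨X.card + 1, by omega, le_rfl, ?_⟩
      ext A
      simp only [Finset.mem_inter, mem_packet, Finset.mem_image, Finset.mem_Icc]
      constructor
      · rintro ⟨⟨y, hy, rfl⟩, hA⟩; exact absurd ⟨y, hy, hA⟩ hne
      · rintro ⟨j, ⟨_, _⟩, _⟩; omega

theorem isSuffixOf_iff {X : Finset (Fin n)} {R : Finset (Finset (Fin n))} :
    IsSuffixOf X (packet X ∩ R) ↔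
      ∀ x ∈ X, ∀ y ∈ X, x < y → X.erase y ∈ R → X.erase x ∈ R := by
  constructor
  · rintro ⟨i, h2, h⟩ x hx y hy hxy hR
    have : X.erase y ∈ packet X ∩ R := Finset.mem_inter.2 ⟨mem_packet.2 ⟨y, hy, rfl⟩, hR⟩
    rw [h] at this
    obtain ⟨j, hj, e⟩ := Finset.mem_image.1 this
    rw [Finset.mem_Icc] at hj
    obtain ⟨z, hz, rfl⟩ := exists_rk_eq hj.1 (hj.2.trans h2)
    rw [face_rk hz] at e
    have hzx : z = y := by
      by_contra hne; exact erase_ne_erase hz hne e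
    subst hzx
    have : X.erase x ∈ packet X ∩ R := by
      rw [h, ← face_rk hx]
      exact Finset.mem_image_of_mem _ (Finset.mem_Icc.2
        ⟨(Finset.mem_Icc.1 (rk_mem_Icc hx)).1, (rk_lt_rk hz hxy).le.trans hj.2⟩)
    exact (Finset.mem_inter.1 this).2
  · intro h
    by_cases hne : ∃ x ∈ X, X.erase x ∈ R
    · have hne' : (X.filter fun x => X.erase x ∈ R).Nonempty := by
        obtain ⟨x, hx, hxR⟩ := hne; exact ⟨x, by simp [hx, hxR]⟩
      obtain ⟨x, hx, hmax⟩ := Finset.exists_max_image _ id hne'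
      simp only [Finset.mem_filter, id] at hx hmax
      have hr := Finset.mem_Icc.1 (rk_mem_Icc hx.1)
      refine ⟨rk X x, hr.2, ?_⟩
      ext A
      simp only [Finset.mem_inter, Finset.mem_image, Finset.mem_Icc, mem_packet]
      constructor
      · rintro ⟨⟨y, hy, rfl⟩, hA⟩
        refine ⟨rk X y, ⟨(Finset.mem_Icc.1 (rk_mem_Icc hy)).1, ?_⟩, face_rk hy⟩
        rcases (hmax y ⟨hy, hA⟩).eq_or_lt with e | e
        · rw [e]
        · exact (rk_lt_rk hx.1 e).le
      · rintro ⟨j, ⟨hj, hj'⟩, rfl⟩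
        obtain ⟨y, hy, rfl⟩ := exists_rk_eq hj (hj'.trans hr.2)
        rw [face_rk hy]
        refine ⟨⟨y, hy, rfl⟩, ?_⟩
        rcases lt_trichotomy y x with e | e | e
        · exact h y hy x hx.1 e hx.2
        · rw [e]; exact hx.2
        · exact absurd (rk_lt_rk hy e) (by omega)
    · refine ⟨0, by omega, ?_⟩
      ext A
      simp only [Finset.mem_inter, mem_packet, Finset.mem_image, Finset.mem_Icc]
      constructor
      · rintro ⟨⟨y, hy, rfl⟩, hA⟩; exact absurd ⟨y, hy, hA⟩ hne
      · rintro ⟨j, ⟨_, _⟩, _⟩; omega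

/-- A family meets the packet of `X` in a prefix or a suffix iff it does not separate the middle
one of three faces from the two others. -/
theorem isPrefixOf_or_isSuffixOf_iff {X : Finset (Fin n)} {R : Finset (Finset (Fin n))} :
    (IsPrefixOf X (packet X ∩ R) ∨ IsSuffixOf X (packet X ∩ R)) ↔
      ∀ a ∈ X, ∀ b ∈ X, ∀ c ∈ X, a < b → b < c →
        (X.erase a ∈ R → X.erase c ∈ R → X.erase b ∈ R) ∧
        (X.erase a ∉ R → X.erase c ∉ R → X.erase b ∉ R) := by
  rw [isPrefixOf_iff, isSuffixOf_iff]
  constructor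
  · rintro (h | h) a ha b hb c hc hab hbc
    · exact ⟨fun h1 _ => h a ha b hb hab h1, fun _ h2 h3 => h2 (h b hb c hc hbc h3)⟩
    · exact ⟨fun _ h1 => h b hb c hc hbc h1, fun h2 _ h3 => h2 (h a ha b hb hab h3)⟩
  · intro h
    by_contra! hcon
    obtain ⟨⟨x, hx, y, hy, hxy, hxR, hyR⟩, ⟨x', hx', y', hy', hxy', hyR', hxR'⟩⟩ := hcon
    rcases lt_trichotomy x x' with e | e | e
    · have h1 := (h x hx x' hx' y' hy' e hxy').1 hxR hyR'
      exact hxR' h1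
    · subst e; exact hxR' hxR
    · have h1 : y < y' → False := fun h1 => (h x' hx' x hx y hy e hxy).2 hxR' hyR hxR
      rcases lt_trichotomy y y' with e' | e' | e'
      · exact h1 e'
      · subst e'; exact hyR hyR'
      · exact (h x' hx' x hx y hy e hxy).2 hxR' hyR hxR

/-! ### Quasi-inversions -/

theorem not_inv_trans {w : Equiv.Perm (Fin n)} {x y : Fin n} (hxy : x ≠ y)
    (h : ¬ w⁻¹ y < w⁻¹ x) : w⁻¹ x < w⁻¹ y :=
  lt_of_le_of_ne (not_lt.1 h) fun e => hxy (w⁻¹.injective e)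

/-- Between the two entries of a non-inversion there are no entries of a common inversion. -/
theorem lt_iff_lt_of_insert_mem {w : Equiv.Perm (Fin n)} {k : ℕ} {C : Finset (Fin n)}
    {x y c : Fin n} (hxy : x < y) (hw : w⁻¹ x < w⁻¹ y) (hy : y ∉ C)
    (hCx : insert x C ∈ Inv w k) (hCy : insert y C ∈ Inv w k) (hc : c ∈ C) :
    y < c ↔ x < c := by
  constructor
  · exact hxy.trans
  · intro h
    by_contra hyc
    have hne : c ≠ y := fun e => hy (e ▸ hc)
    have h1 := (mem_Inv.1 hCx).2 x (by simp) c (by simp [hc]) h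
    have h2 := (mem_Inv.1 hCy).2 c (by simp [hc]) y (by simp)
      (lt_of_le_of_ne (not_lt.1 hyc) hne)
    exact absurd (h2.trans h1) hw.asymm

/-- Every pair other than `(x, y)` lies inside one of the two inversions `insert x C` and `insert y
C`. -/
theorem isQuasiInversion_insert {w : Equiv.Perm (Fin n)} {k : ℕ} {C : Finset (Fin n)}
    {x y : Fin n} (hxy : x < y) (hw : w⁻¹ x < w⁻¹ y)
    (hCx : insert x C ∈ Inv w k) (hCy : insert y C ∈ Inv w k) :
    IsQuasiInversion w (insert x (insert y C)) := by
  rw [IsQuasiInversion, Finset.card_eq_one]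
  refine ⟨(x, y), ?_⟩
  ext ⟨a, b⟩
  simp only [Finset.mem_filter, Finset.mem_product, Finset.mem_singleton, Prod.mk.injEq]
  constructor
  · rintro ⟨⟨ha, hb⟩, hab, h⟩
    by_contra hne
    apply h
    by_cases h1 : a ∈ insert x C ∧ b ∈ insert x C
    · exact (mem_Inv.1 hCx).2 a h1.1 b h1.2 hab
    · by_cases h2 : a ∈ insert y C ∧ b ∈ insert y C
      · exact (mem_Inv.1 hCy).2 a h2.1 b h2.2 hab
      · simp only [Finset.mem_insert] at ha hb h1 h2
        grind
  · rintro ⟨rfl, rfl⟩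
    exact ⟨⟨by simp, by simp⟩, hxy, hw.asymm⟩

theorem card_insert_insert {w : Equiv.Perm (Fin n)} {k : ℕ} {C : Finset (Fin n)}
    {x y : Fin n} (hxy : x ≠ y) (hx : x ∉ C) (hCy : insert y C ∈ Inv w k) :
    (insert x (insert y C)).card = k + 1 := by
  rw [Finset.card_insert_of_notMem (by simp [hxy, hx]), (mem_Inv.1 hCy).1]

theorem erase_insert_insert_left {C : Finset (Fin n)} {x y : Fin n} (hxy : x ≠ y) (hx : x ∉ C) :
    (insert x (insert y C)).erase x = insert y C :=
  Finset.erase_insert (by simp [hxy, hx])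

theorem erase_insert_insert_right {C : Finset (Fin n)} {x y : Fin n} (hxy : x ≠ y) (hy : y ∉ C) :
    (insert x (insert y C)).erase y = insert x C := by
  rw [Finset.insert_comm]
  exact Finset.erase_insert (by simp [hxy.symm, hy])

theorem rk_add_card_filter {X : Finset (Fin n)} (x : Fin n) :
    rk X x + (X.filter fun z => x < z).card = X.card := by
  rw [rk, ← Finset.card_filter_add_card_filter_not (s := X) (fun y => y ≤ x)]
  simp only [not_le]

theorem filter_lt_insert_insert {C : Finset (Fin n)} {x y : Fin n} (hxy : x < y) :
    ((insert x (insert y C)).filter fun z => y < z) = C.filter fun z => y < z := by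
  ext z
  simp only [Finset.mem_filter, Finset.mem_insert]
  constructor
  · rintro ⟨rfl | rfl | h, h'⟩
    · exact absurd h' hxy.asymm
    · exact absurd h' (lt_irrefl _)
    · exact ⟨h, h'⟩
  · rintro ⟨h, h'⟩; exact ⟨Or.inr (Or.inr h), h'⟩

/-- The quasi-inversion relations in terms of the codimension two face that is common to the two
faces of a quasi-inversion. -/
theorem quasiRel_iff {w : Equiv.Perm (Fin n)} {k : ℕ} {A B : Finset (Fin n)} :
    QuasiRel w k A B ↔ ∃ (C : Finset (Fin n)) (x y : Fin n), x < y ∧ w⁻¹ x < w⁻¹ y ∧ x ∉ C ∧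
      y ∉ C ∧ insert x C ∈ Inv w k ∧ insert y C ∈ Inv w k ∧
      ((Even (C.filter fun z => y < z).card ∧ A = insert x C ∧ B = insert y C) ∨
       (Odd (C.filter fun z => y < z).card ∧ A = insert y C ∧ B = insert x C)) := by
  constructor
  · rintro ⟨X, hX, hq, i, h1, h2, hp, h⟩
    obtain ⟨u, hu, hui⟩ := exists_rk_eq (X := X) (i := i) h1 (by omega)
    obtain ⟨v, hv, hvi⟩ := exists_rk_eq (X := X) (i := i + 1) (by omega) (by omega)
    have huv : u < v := by
      rcases lt_trichotomy u v with e | e | e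
      · exact e
      · subst e; omega
      · exact absurd (rk_lt_rk hu e) (by omega)
    rw [← hvi, ← hui, face_rk hu, face_rk hv] at hp h
    have hXu : X.erase u ∈ Inv w k :=
      (Finset.mem_inter.1 (hp ▸ Finset.mem_insert_self _ _ :
        X.erase u ∈ packet X ∩ Inv w k)).2
    have hXv : X.erase v ∈ Inv w k :=
      (Finset.mem_inter.1 (hp ▸ by simp : X.erase v ∈ packet X ∩ Inv w k)).2
    obtain ⟨⟨x, y⟩, hxy⟩ := Finset.card_eq_one.1 hq
    have hxy' := Finset.mem_singleton_self (x, y)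
    rw [← hxy] at hxy'
    simp only [Finset.mem_filter, Finset.mem_product] at hxy'
    obtain ⟨⟨hx, hy⟩, hlt, hw⟩ := hxy'
    -- A face that is an inversion must omit an entry of the unique non-inverted pair, so `u` and
    -- `v` are that pair.
    have key : ∀ z, X.erase z ∈ Inv w k → z = x ∨ z = y := by
      intro z hz
      by_contra hcon
      push Not at hcon
      exact hw ((mem_Inv.1 hz).2 x (by simp [hx, hcon.1.symm]) y (by simp [hy, hcon.2.symm]) hlt)
    have hux : u = x ∧ v = y := by
      rcases key u hXu with rfl | rfl <;> rcases key v hXv with rfl | rfl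
      · exact absurd huv (lt_irrefl _)
      · exact ⟨rfl, rfl⟩
      · exact absurd huv hlt.asymm
      · exact absurd huv (lt_irrefl _)
    obtain ⟨rfl, rfl⟩ := hux
    have e1 : insert u ((X.erase u).erase v) = X.erase v := by
      rw [Finset.erase_right_comm, Finset.insert_erase (by simp [hu, hlt.ne])]
    have e2 : insert v ((X.erase u).erase v) = X.erase u := by
      rw [Finset.insert_erase (by simp [hv, hlt.ne'])]
    refine ⟨(X.erase u).erase v, u, v, hlt, not_inv_trans hlt.ne hw, by simp, by simp,
      by rwa [e1], by rwa [e2], ?_⟩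
    have hc : (((X.erase u).erase v).filter fun z => v < z).card = k - i := by
      have h3 := rk_add_card_filter (X := X) v
      have h4 : insert u (insert v ((X.erase u).erase v)) = X := by
        rw [e2, Finset.insert_erase hu]
      rw [← filter_lt_insert_insert huv, h4]
      omega
    rw [hc, e1, e2, ← hui]
    tauto
  · rintro ⟨C, x, y, hxy, hw, hx, hy, hCx, hCy, h⟩
    have hc := card_insert_insert hxy.ne hx hCy
    have hyX : y ∈ insert x (insert y C) := by simp
    have hxX : x ∈ insert x (insert y C) := by simp
    -- No entry of `C` lies between `x` and `y`, so they occupy consecutive positions.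
    have hsub : rk (insert x (insert y C)) y = rk (insert x (insert y C)) x + 1 := by
      have h1 := rk_add_card_filter (X := insert x (insert y C)) y
      have h2 := rk_add_card_filter (X := insert x (insert y C)) x
      have h3 : ((insert x (insert y C)).filter fun z => x < z) =
          insert y ((insert x (insert y C)).filter fun z => y < z) := by
        rw [filter_lt_insert_insert hxy]
        ext z
        simp only [Finset.mem_filter, Finset.mem_insert]
        constructor
        · rintro ⟨rfl | rfl | h, h'⟩
          · exact absurd h' (lt_irrefl _)
          · exact Or.inl rfl
          · exact Or.inr ⟨h, (lt_iff_lt_of_insert_mem hxy hw hy hCx hCy h).2 h'⟩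
        · rintro (rfl | ⟨h, h'⟩)
          · exact ⟨by simp, hxy⟩
          · exact ⟨by simp [h], hxy.trans h'⟩
      rw [h3, Finset.card_insert_of_notMem (by simp)] at h2
      omega
    have hrx := Finset.mem_Icc.1 (rk_mem_Icc hxX)
    have hry := Finset.mem_Icc.1 (rk_mem_Icc hyX)
    refine ⟨insert x (insert y C), hc, isQuasiInversion_insert hxy hw hCx hCy,
      rk (insert x (insert y C)) x, hrx.1, by omega, ?_, ?_⟩
    · rw [← hsub, face_rk hxX, face_rk hyX]
      ext A
      simp only [Finset.mem_inter, mem_packet, Finset.mem_insert (b := (insert x (insert y C)).erase x),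
        Finset.mem_singleton]
      constructor
      · rintro ⟨⟨z, hz, rfl⟩, hA⟩
        by_contra hcon
        push Not at hcon
        have hzx : x ≠ z := by rintro rfl; exact hcon.1 rfl
        have hzy : y ≠ z := by rintro rfl; exact hcon.2 rfl
        exact hw.asymm ((mem_Inv.1 hA).2 x (by simp [hzx]) y (by simp [hzy]) hxy)
      · rintro (rfl | rfl)
        · exact ⟨⟨x, hxX, rfl⟩, by rwa [erase_insert_insert_left hxy.ne hx]⟩
        · exact ⟨⟨y, hyX, rfl⟩, by rwa [erase_insert_insert_right hxy.ne hy]⟩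
    · rw [← hsub, face_rk hxX, face_rk hyX, erase_insert_insert_left hxy.ne hx,
        erase_insert_insert_right hxy.ne hy]
      have h1 := rk_add_card_filter (X := insert x (insert y C)) y
      rw [filter_lt_insert_insert hxy] at h1
      have h2 : k - rk (insert x (insert y C)) x = (C.filter fun z => y < z).card := by omega
      rw [h2]
      tauto

/-! ### Orientations of packets; consistency as local transitivity -/

/-- The orientation of the packet of `X` prescribed by `R` (for an inversion `X`) or by the
permanent poset (for a quasi-inversion `X`): it holds if the larger entries come last. -/
def Flipped (w : Equiv.Perm (Fin n)) (R : Finset (Finset (Fin n))) (X : Finset (Fin n)) : Prop :=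
  X ∈ R ∨ ∃ x ∈ X, ∃ y ∈ X, x < y ∧ w⁻¹ x < w⁻¹ y ∧ Odd (X.filter fun z => y < z).card

/-- The relation on `Inv w k` generated by orienting packets as `T` prescribes. -/
def Prec (w : Equiv.Perm (Fin n)) (k : ℕ) (T : Finset (Fin n) → Prop) (A B : Finset (Fin n)) :
    Prop :=
  ∃ (C : Finset (Fin n)) (x y : Fin n), x < y ∧ x ∉ C ∧ y ∉ C ∧ insert x C ∈ Inv w k ∧
    insert y C ∈ Inv w k ∧ ((¬ T (insert x (insert y C)) ∧ A = insert x C ∧ B = insert y C) ∨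
      (T (insert x (insert y C)) ∧ A = insert y C ∧ B = insert x C))

/-- The orientation `T` orders the link of every `(k-1)`-inversion linearly. -/
def LocallyTransitive (w : Equiv.Perm (Fin n)) (k : ℕ) (T : Finset (Fin n) → Prop) : Prop :=
  ∀ (C : Finset (Fin n)) (a b c : Fin n), a < b → b < c → a ∉ C → b ∉ C → c ∉ C →
    insert a C ∈ Inv w k → insert b C ∈ Inv w k → insert c C ∈ Inv w k →
    (T (insert a (insert b C)) → T (insert b (insert c C)) → T (insert a (insert c C))) ∧
    (¬ T (insert a (insert b C)) → ¬ T (insert b (insert c C)) → ¬ T (insert a (insert c C)))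

theorem insert_insert_mem_Inv {w : Equiv.Perm (Fin n)} {k : ℕ} {C : Finset (Fin n)}
    {x y : Fin n} (hxy : x < y) (hw : ¬ w⁻¹ x < w⁻¹ y) (hx : x ∉ C)
    (hCx : insert x C ∈ Inv w k) (hCy : insert y C ∈ Inv w k) :
    insert x (insert y C) ∈ Inv w (k + 1) := by
  refine mem_Inv.2 ⟨card_insert_insert hxy.ne hx hCy, fun a ha b hb hab => ?_⟩
  have hw' : w⁻¹ y < w⁻¹ x := not_inv_trans hxy.ne' hw
  by_cases h1 : a ∈ insert x C ∧ b ∈ insert x C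
  · exact (mem_Inv.1 hCx).2 a h1.1 b h1.2 hab
  · by_cases h2 : a ∈ insert y C ∧ b ∈ insert y C
    · exact (mem_Inv.1 hCy).2 a h2.1 b h2.2 hab
    · have : a = x ∧ b = y := by
        simp only [Finset.mem_insert] at ha hb h1 h2
        grind
      rw [this.1, this.2]; exact hw'

theorem flipped_of_mem_Inv {w : Equiv.Perm (Fin n)} {j : ℕ} {R : Finset (Finset (Fin n))}
    {X : Finset (Fin n)} (hX : X ∈ Inv w j) : Flipped w R X ↔ X ∈ R := by
  constructor
  · rintro (h | ⟨x, hx, y, hy, hxy, hw, -⟩)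
    · exact h
    · exact absurd ((mem_Inv.1 hX).2 x hx y hy hxy) hw.asymm
  · exact Or.inl

/-- The union is a quasi-inversion, so it is not in `R`, and the pair in the second alternative of
`Flipped` can only be `(x, y)`. -/
theorem flipped_iff_odd {w : Equiv.Perm (Fin n)} {k j : ℕ} {R : Finset (Finset (Fin n))}
    (hR : R ⊆ Inv w j) {C : Finset (Fin n)} {x y : Fin n} (hxy : x < y) (hw : w⁻¹ x < w⁻¹ y)
    (hCx : insert x C ∈ Inv w k) (hCy : insert y C ∈ Inv w k) :
    Flipped w R (insert x (insert y C)) ↔ Odd (C.filter fun z => y < z).card := by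
  rw [← filter_lt_insert_insert hxy]
  constructor
  · rintro (h | ⟨a, ha, b, hb, hab, hw', hodd⟩)
    · exact absurd ((mem_Inv.1 (hR h)).2 x (by simp) y (by simp) hxy) hw.asymm
    · have h3 := isQuasiInversion_insert hxy hw hCx hCy
      obtain ⟨p, hp⟩ := Finset.card_eq_one.1 h3
      have h4 : (x, y) = p := by
        rw [← Finset.mem_singleton, ← hp]
        simp only [Finset.mem_filter, Finset.mem_product]
        exact ⟨⟨by simp, by simp⟩, hxy, hw.asymm⟩
      have h5 : (a, b) = p := by
        rw [← Finset.mem_singleton, ← hp]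
        simp only [Finset.mem_filter, Finset.mem_product]
        exact ⟨⟨ha, hb⟩, hab, hw'.asymm⟩
      rw [← h4, Prod.mk.injEq] at h5
      rwa [h5.2] at hodd
  · intro h
    exact Or.inr ⟨x, by simp, y, by simp, hxy, hw, h⟩

theorem quasiRel_prec {w : Equiv.Perm (Fin n)} {k j : ℕ} {R : Finset (Finset (Fin n))}
    (hR : R ⊆ Inv w j) {A B : Finset (Fin n)} (h : QuasiRel w k A B) :
    Prec w k (Flipped w R) A B := by
  obtain ⟨C, x, y, hxy, hw, hx, hy, hCx, hCy, h⟩ := quasiRel_iff.1 h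
  refine ⟨C, x, y, hxy, hx, hy, hCx, hCy, ?_⟩
  rw [flipped_iff_odd hR hxy hw hCx hCy, Nat.not_odd_iff_even]
  exact h

theorem QuasiRel.mem_Inv {w : Equiv.Perm (Fin n)} {k : ℕ} {A B : Finset (Fin n)}
    (h : QuasiRel w k A B) : A ∈ Inv w k ∧ B ∈ Inv w k := by
  obtain ⟨C, x, y, hxy, hw, hx, hy, hCx, hCy, h | h⟩ := quasiRel_iff.1 h
  · rw [h.2.1, h.2.2]; exact ⟨hCx, hCy⟩
  · rw [h.2.1, h.2.2]; exact ⟨hCy, hCx⟩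

theorem filter_lt_eq_of_insert_mem {w : Equiv.Perm (Fin n)} {k : ℕ} {C : Finset (Fin n)}
    {x y : Fin n} (hxy : x < y) (hw : w⁻¹ x < w⁻¹ y) (hy : y ∉ C)
    (hCx : insert x C ∈ Inv w k) (hCy : insert y C ∈ Inv w k) :
    (C.filter fun z => y < z) = C.filter fun z => x < z :=
  Finset.filter_congr fun _ hz => lt_iff_lt_of_insert_mem hxy hw hy hCx hCy hz

theorem IsConsistent.mem_of_quasiRel {w : Equiv.Perm (Fin n)} {k : ℕ}
    {R : Finset (Finset (Fin n))} (h : IsConsistent w k R) {A B : Finset (Fin n)}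
    (hAB : QuasiRel w k A B) (hB : B ∈ R) : A ∈ R :=
  h.ideal B hB A hAB.mem_Inv.1 (Relation.ReflTransGen.single hAB)

theorem IsConsistent.of_quasiRel {w : Equiv.Perm (Fin n)} {k : ℕ}
    {R : Finset (Finset (Fin n))} (hR : R ⊆ Inv w k)
    (hstep : ∀ A B, QuasiRel w k A B → B ∈ R → A ∈ R)
    (hmsz : ∀ X ∈ Inv w (k + 1), ∀ a ∈ X, ∀ b ∈ X, ∀ c ∈ X, a < b → b < c →
      (X.erase a ∈ R → X.erase c ∈ R → X.erase b ∈ R) ∧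
      (X.erase a ∉ R → X.erase c ∉ R → X.erase b ∉ R)) : IsConsistent w k R := by
  refine ⟨hR, ?_, fun X hX => isPrefixOf_or_isSuffixOf_iff.2 (hmsz X hX)⟩
  intro X hX Y _ hYX
  induction (show Relation.ReflTransGen (QuasiRel w k) Y X from hYX) with
  | refl => exact hX
  | tail _ h2 ih => exact ih (hstep _ _ h2 hX) (by assumption)

/-- The cases are the patterns of inverted pairs among `a`, `b`, `c`. If `(a, c)` is not inverted,
neither is one of the other two pairs, and it has the same parity because no entry of `C` separates
a non-inverted pair. If only `(b, c)` or only `(a, b)` is not inverted, then `C ∪ {a, b, c}` is a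
quasi-inversion and the ideal property decides. If all pairs are inverted, it is an inversion and
the prefix-or-suffix condition decides. -/
theorem IsConsistent.locallyTransitive {w : Equiv.Perm (Fin n)} {k : ℕ}
    {R : Finset (Finset (Fin n))} (h : IsConsistent w (k + 1) R) :
    LocallyTransitive w k (Flipped w R) := by
  intro C a b c hab hbc ha hb hc hCa hCb hCc
  have hac := hab.trans hbc
  by_cases h1 : w⁻¹ a < w⁻¹ c
  · by_cases h2 : w⁻¹ b < w⁻¹ c
    · rw [flipped_iff_odd h.subset hac h1 hCa hCc, flipped_iff_odd h.subset hbc h2 hCb hCc]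
      exact ⟨fun _ h => h, fun _ h => h⟩
    · by_cases h3 : w⁻¹ a < w⁻¹ b
      · rw [flipped_iff_odd h.subset hac h1 hCa hCc, flipped_iff_odd h.subset hab h3 hCa hCb,
          filter_lt_eq_of_insert_mem hac h1 hc hCa hCc,
          filter_lt_eq_of_insert_mem hab h3 hb hCa hCb]
        exact ⟨fun h _ => h, fun h _ => h⟩
      · exact absurd h1 ((not_inv_trans hbc.ne' h2).trans (not_inv_trans hab.ne' h3)).asymm
  · have hCac := insert_insert_mem_Inv hac h1 ha hCa hCc
    by_cases h2 : w⁻¹ b < w⁻¹ c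
    · have h3 : ¬ w⁻¹ a < w⁻¹ b := fun h3 => h1 (h3.trans h2)
      have hCab := insert_insert_mem_Inv hab h3 ha hCa hCb
      rw [flipped_iff_odd h.subset hbc h2 hCb hCc, flipped_of_mem_Inv hCac,
        flipped_of_mem_Inv hCab]
      have e : ((insert a C).filter fun z => c < z) = C.filter fun z => c < z := by
        rw [Finset.filter_insert, if_neg hac.asymm]
      have hq : ∀ A B, _ → QuasiRel w (k + 1) A B := fun A B hyp =>
        quasiRel_iff.2 ⟨insert a C, b, c, hbc, h2, by simp [hb, hab.ne'], by simp [hc, hac.ne'],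
          by rwa [Finset.insert_comm], by rwa [Finset.insert_comm], hyp⟩
      rw [e, Finset.insert_comm b, Finset.insert_comm c] at hq
      constructor
      · intro hR hodd
        exact h.mem_of_quasiRel (hq _ _ (Or.inr ⟨hodd, rfl, rfl⟩)) hR
      · intro hR hodd hR'
        exact hR (h.mem_of_quasiRel (hq _ _
          (Or.inl ⟨Nat.not_odd_iff_even.1 hodd, rfl, rfl⟩)) hR')
    · have hCbc := insert_insert_mem_Inv hbc h2 hb hCb hCc
      by_cases h3 : w⁻¹ a < w⁻¹ b
      · rw [flipped_iff_odd h.subset hab h3 hCa hCb, flipped_of_mem_Inv hCac,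
          flipped_of_mem_Inv hCbc]
        -- The common face now contains `c`, which lies above the pair `(a, b)`, so the parity
        -- changes. In the preceding case the common face gains `a`, which lies below the pair.
        have e : ((insert c C).filter fun z => b < z).card =
            (C.filter fun z => b < z).card + 1 := by
          rw [Finset.filter_insert, if_pos hbc, Finset.card_insert_of_notMem (by simp [hc])]
        have hq : ∀ A B, _ → QuasiRel w (k + 1) A B := fun A B hyp =>
          quasiRel_iff.2 ⟨insert c C, a, b, hab, h3, by simp [ha, hac.ne], by simp [hb, hbc.ne],
            hCac, hCbc, hyp⟩
        rw [e] at hq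
        constructor
        · intro hodd hR
          exact h.mem_of_quasiRel (hq _ _ (Or.inl ⟨hodd.add_one, rfl, rfl⟩)) hR
        · intro hodd hR hR'
          exact hR (h.mem_of_quasiRel (hq _ _
            (Or.inr ⟨(Nat.not_odd_iff_even.1 hodd).add_one, rfl, rfl⟩)) hR')
      · have hCab := insert_insert_mem_Inv hab h3 ha hCa hCb
        rw [flipped_of_mem_Inv hCab, flipped_of_mem_Inv hCac, flipped_of_mem_Inv hCbc]
        have hX : insert a (insert b (insert c C)) ∈ Inv w (k + 1 + 1) :=
          insert_insert_mem_Inv hab h3 (by simp [ha, hac.ne]) hCac hCbc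
        have hm := isPrefixOf_or_isSuffixOf_iff.1 (h.msz _ hX) a (by simp) b (by simp) c (by simp)
          hab hbc
        rw [erase_insert_insert_left hab.ne (by simp [ha, hac.ne]),
          erase_insert_insert_right hab.ne (by simp [hb, hbc.ne]), Finset.insert_comm b c,
          Finset.insert_comm a c, Finset.erase_insert (by simp [hc, hac.ne', hbc.ne']),
          Finset.insert_comm c b] at hm
        exact ⟨fun h1 h2 => hm.1 h2 h1, fun h1 h2 => hm.2 h2 h1⟩

/-- A quasi-inversion relation between `(k+1)`-inversions has a common face `D` with `k` entries.
Since `k > 0`, some `d` can be taken out of `D`, and local transitivity for `d` and the non-inverted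
pair yields the ideal property. -/
theorem LocallyTransitive.isConsistent {w : Equiv.Perm (Fin n)} {k : ℕ} (hk : 0 < k)
    {R : Finset (Finset (Fin n))} (hR : R ⊆ Inv w (k + 1))
    (h : LocallyTransitive w k (Flipped w R)) : IsConsistent w (k + 1) R := by
  have hstep : ∀ A B, QuasiRel w (k + 1) A B → B ∈ R → A ∈ R := by
    intro A B hAB hB
    obtain ⟨D, x, y, hxy, hw, hx, hy, hDx, hDy, hyp⟩ := quasiRel_iff.1 hAB
    have hD : 0 < D.card := by
      have := (mem_Inv.1 hDx).1
      rw [Finset.card_insert_of_notMem hx] at this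
      omega
    obtain ⟨d, hd⟩ := Finset.card_pos.1 hD
    obtain ⟨C, hdC, rfl⟩ : ∃ C, d ∉ C ∧ insert d C = D :=
      ⟨D.erase d, by simp, Finset.insert_erase hd⟩
    simp only [Finset.mem_insert, not_or] at hx hy
    have hdx : d ≠ x := hx.1 ∘ Eq.symm
    have hdy : d ≠ y := hy.1 ∘ Eq.symm
    have hCx : insert x C ∈ Inv w k := by
      have := erase_mem_Inv hDx (x := d) (by simp)
      rwa [erase_insert_insert_right hx.1 hdC] at this
    have hCy : insert y C ∈ Inv w k := by
      have := erase_mem_Inv hDy (x := d) (by simp)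
      rwa [erase_insert_insert_right hy.1 hdC] at this
    have hCd : insert d C ∈ Inv w k := by
      have := erase_mem_Inv hDx (x := x) (by simp)
      rwa [erase_insert_insert_left hx.1 hx.2] at this
    -- The entry `d` lies outside the interval from `x` to `y`: below it leaves the parity
    -- unchanged, above it shifts the parity by one.
    have hlt := lt_iff_lt_of_insert_mem hxy hw (by simp [hy]) hDx hDy (c := d) (by simp)
    rcases lt_or_gt_of_ne hdx with e | e
    · have hl := h C d x y e hxy hdC hx.2 hy.2 hCd hCx hCy
      rw [Finset.insert_comm d x, Finset.insert_comm d y, flipped_of_mem_Inv hDx,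
        flipped_of_mem_Inv hDy, flipped_iff_odd hR hxy hw hCx hCy] at hl
      rw [Finset.filter_insert, if_neg (e.trans hxy).asymm] at hyp
      rcases hyp with ⟨hp, rfl, rfl⟩ | ⟨hp, rfl, rfl⟩
      · by_contra hc; exact hl.2 hc (Nat.not_odd_iff_even.2 hp) hB
      · exact hl.1 hB hp
    · have e' := hlt.2 e
      have hl := h C x y d hxy e' hx.2 hy.2 hdC hCx hCy hCd
      rw [flipped_of_mem_Inv hDx, flipped_of_mem_Inv hDy, flipped_iff_odd hR hxy hw hCx hCy] at hl
      rw [Finset.filter_insert, if_pos e', Finset.card_insert_of_notMem (by simp [hdC])] at hyp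
      rcases hyp with ⟨hp, rfl, rfl⟩ | ⟨hp, rfl, rfl⟩
      · exact hl.1 (by simpa [Nat.even_add_one] using hp) hB
      · by_contra hc; exact hl.2 (by simpa [Nat.odd_add_one] using hp) hc hB
  refine .of_quasiRel hR hstep ?_
  · intro X hX a ha b hb c hc hab hbc
    have hac := hab.trans hbc
    obtain ⟨C, haC, hbC, hcC, rfl⟩ : ∃ C, a ∉ C ∧ b ∉ C ∧ c ∉ C ∧
        insert a (insert b (insert c C)) = X := by
      refine ⟨((X.erase a).erase b).erase c, by simp, by simp, by simp, ?_⟩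
      rw [Finset.insert_erase (by simp [hc, hac.ne', hbc.ne']),
        Finset.insert_erase (by simp [hb, hab.ne']), Finset.insert_erase ha]
    have e1 := erase_insert_insert_left (C := insert c C) hab.ne (by simp [haC, hac.ne])
    have e2 := erase_insert_insert_right (C := insert c C) hab.ne (by simp [hbC, hbc.ne])
    have e3 : (insert a (insert b (insert c C))).erase c = insert a (insert b C) := by
      rw [Finset.insert_comm b c, Finset.insert_comm a c,
        Finset.erase_insert (by simp [hcC, hac.ne', hbc.ne'])]
    have i1 := erase_mem_Inv hX ha
    have i2 := erase_mem_Inv hX hb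
    have i3 := erase_mem_Inv hX hc
    rw [e1] at i1
    rw [e2] at i2
    rw [e3] at i3
    have j1 := erase_mem_Inv i2 (x := c) (by simp)
    have j2 := erase_mem_Inv i1 (x := c) (by simp)
    have j3 := erase_mem_Inv i2 (x := a) (by simp)
    rw [erase_insert_insert_right hac.ne hcC] at j1
    rw [erase_insert_insert_right hbc.ne hcC] at j2
    rw [erase_insert_insert_left hac.ne haC] at j3
    have hl := h C a b c hab hbc haC hbC hcC j1 j2 j3
    rw [flipped_of_mem_Inv i1, flipped_of_mem_Inv i2, flipped_of_mem_Inv i3] at hl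
    rw [e1, e2, e3]
    exact ⟨fun h1 h2 => hl.1 h2 h1, fun h1 h2 => hl.2 h2 h1⟩

/-! ### Acyclicity -/

/-- A locally transitive orientation that orients quasi-inversions according to a parity is
acyclic: it admits a height function.  Both hypotheses and the conclusion are relative to a
ground set `S`, whose largest entry is deleted in the induction. -/
theorem exists_height_on (w : Equiv.Perm (Fin n)) (N : ℕ) :
    ∀ (S : Finset (Fin n)) (k ε : ℕ) (T : Finset (Fin n) → Prop), S.card ≤ N →
    (∀ (C : Finset (Fin n)) (a b c : Fin n), C ⊆ S → a ∈ S → b ∈ S → c ∈ S → a < b → b < c →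
      a ∉ C → b ∉ C → c ∉ C →
      insert a C ∈ Inv w k → insert b C ∈ Inv w k → insert c C ∈ Inv w k →
      (T (insert a (insert b C)) → T (insert b (insert c C)) → T (insert a (insert c C))) ∧
      (¬ T (insert a (insert b C)) → ¬ T (insert b (insert c C)) →
        ¬ T (insert a (insert c C)))) →
    (∀ (C : Finset (Fin n)) (x y : Fin n), C ⊆ S → x ∈ S → y ∈ S → x < y → w⁻¹ x < w⁻¹ y →
      x ∉ C → y ∉ C → insert x C ∈ Inv w k → insert y C ∈ Inv w k →
      (T (insert x (insert y C)) ↔ Odd ((C.filter fun z => y < z).card + ε))) →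
    ∃ f : Finset (Fin n) → ℤ, ∀ (C : Finset (Fin n)) (x y : Fin n), C ⊆ S → x ∈ S → y ∈ S →
      x < y → x ∉ C → y ∉ C → insert x C ∈ Inv w k → insert y C ∈ Inv w k →
      (¬ T (insert x (insert y C)) → f (insert x C) < f (insert y C)) ∧
      (T (insert x (insert y C)) → f (insert y C) < f (insert x C)) := by
  induction N with
  | zero =>
    intro S k ε T hS _ _
    refine ⟨fun _ => 0, fun C x y _ hx => ?_⟩
    rw [Finset.card_eq_zero.1 (Nat.le_zero.1 hS)] at hx
    simp at hx
  | succ N ih =>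
    intro S k ε T hS hT hp
    -- Complementing `T` shifts `ε` by one and negates the height. With `ε` even, a non-inverted
    -- pair `(x, m)` with `m` largest is never flipped.
    wlog hε : Even ε generalizing T ε
    · obtain ⟨f, hf⟩ := this (ε + 1) (fun X => ¬ T X)
        (fun C a b c hC ha hb hc hab hbc ha' hb' hc' h1 h2 h3 => by
          have := hT C a b c hC ha hb hc hab hbc ha' hb' hc' h1 h2 h3
          exact ⟨this.2, by simpa using this.1⟩)
        (fun C x y hC hx hy hxy hw hx' hy' h1 h2 => by
          rw [hp C x y hC hx hy hxy hw hx' hy' h1 h2, ← add_assoc, Nat.odd_add_one])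
        (Nat.not_even_iff_odd.1 hε).add_one
      refine ⟨fun Z => - f Z, fun C x y hC hx hy hxy hx' hy' h1 h2 => ?_⟩
      have := hf C x y hC hx hy hxy hx' hy' h1 h2
      simp only [neg_lt_neg_iff]
      exact ⟨this.2, fun h => this.1 (not_not_intro h)⟩
    rcases S.eq_empty_or_nonempty with rfl | hne
    · exact ⟨fun _ => 0, fun C x y _ hx => by simp at hx⟩
    rcases k with _ | k
    · refine ⟨fun _ => 0, fun C x y _ _ _ _ _ _ h => ?_⟩
      have := (mem_Inv.1 h).1
      simp at this
    obtain ⟨m, hmS, hmax⟩ := Finset.exists_max_image S id hne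
    simp only [id] at hmax
    set S₁ := S.erase m with hS₁
    have hS₁S : S₁ ⊆ S := Finset.erase_subset _ _
    have hmS₁ : m ∉ S₁ := by simp [hS₁]
    have hlt : ∀ x ∈ S₁, x < m := fun x hx =>
      lt_of_le_of_ne (hmax x (hS₁S hx)) (Finset.ne_of_mem_erase hx)
    have hcard : S₁.card ≤ N := by rw [hS₁, Finset.card_erase_of_mem hmS]; omega
    -- The link of `m`: an inversion contained in `S` and containing `m` is `insert m Z` with `Z ⊆
    -- M`.
    set M := S₁.filter fun x => w⁻¹ m < w⁻¹ x with hM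
    have hMS₁ : M ⊆ S₁ := Finset.filter_subset _ _
    have hinsM : ∀ {Z : Finset (Fin n)}, Z ⊆ M → Z ∈ Inv w k → insert m Z ∈ Inv w (k + 1) := by
      intro Z hZ hZk
      refine mem_Inv.2 ⟨?_, ?_⟩
      · rw [Finset.card_insert_of_notMem fun h => hmS₁ (hMS₁ (hZ h)), (mem_Inv.1 hZk).1]
      · intro x hx y hy hxy
        rw [Finset.mem_insert] at hx hy
        rcases hx with rfl | hx <;> rcases hy with rfl | hy
        · exact absurd hxy (lt_irrefl _)
        · exact absurd hxy (hlt y (hMS₁ (hZ hy))).asymm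
        · exact (Finset.mem_filter.1 (hZ hx)).2
        · exact (mem_Inv.1 hZk).2 x hx y hy hxy
    obtain ⟨f₁, hf₁⟩ := ih S₁ (k + 1) ε T hcard
      (fun C a b c hC ha hb hc => hT C a b c (hC.trans hS₁S) (hS₁S ha) (hS₁S hb) (hS₁S hc))
      (fun C x y hC hx hy => hp C x y (hC.trans hS₁S) (hS₁S hx) (hS₁S hy))
    have hcomm : ∀ (a b : Fin n) (C : Finset (Fin n)),
        insert m (insert a (insert b C)) = insert a (insert b (insert m C)) := fun a b C => by
      rw [Finset.insert_comm m a, Finset.insert_comm m b]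
    have hMm : ∀ {x}, x ∈ M → x ≠ m := fun hx e => hmS₁ (e ▸ hMS₁ hx)
    -- Every count of larger entries gains the entry `m`; the shift to `ε + 1` absorbs it.
    obtain ⟨f₂, hf₂⟩ := ih M k (ε + 1) (fun X => T (insert m X))
      ((Finset.card_le_card hMS₁).trans hcard)
      (fun C a b c hC ha hb hc hab hbc ha' hb' hc' h1 h2 h3 => by
        simp only [hcomm]
        refine hT (insert m C) a b c ?_ (hS₁S (hMS₁ ha)) (hS₁S (hMS₁ hb)) (hS₁S (hMS₁ hc)) hab hbc
          (by simp [ha', hMm ha]) (by simp [hb', hMm hb]) (by simp [hc', hMm hc]) ?_ ?_ ?_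
        · exact Finset.insert_subset hmS (hC.trans (hMS₁.trans hS₁S))
        · rw [Finset.insert_comm]; exact hinsM (Finset.insert_subset ha hC) h1
        · rw [Finset.insert_comm]; exact hinsM (Finset.insert_subset hb hC) h2
        · rw [Finset.insert_comm]; exact hinsM (Finset.insert_subset hc hC) h3)
      (fun C x y hC hx hy hxy hw hx' hy' h1 h2 => by
        simp only [hcomm]
        rw [hp (insert m C) x y (Finset.insert_subset hmS (hC.trans (hMS₁.trans hS₁S)))
          (hS₁S (hMS₁ hx)) (hS₁S (hMS₁ hy)) hxy hw (by simp [hx', hMm hx]) (by simp [hy', hMm hy])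
          (by rw [Finset.insert_comm]; exact hinsM (Finset.insert_subset hx hC) h1)
          (by rw [Finset.insert_comm]; exact hinsM (Finset.insert_subset hy hC) h2),
          Finset.filter_insert, if_pos (hlt y (hMS₁ hy)),
          Finset.card_insert_of_notMem fun h => hmS₁ (hMS₁ (hC (Finset.mem_filter.1 h).1)),
          add_assoc, add_comm 1 ε])
    -- A bound on both heights, so that a shift by `2 * B` puts one family entirely above or below
    -- the other.
    obtain ⟨B, hB⟩ : ∃ B : ℤ, ∀ Z Z', |f₁ Z| + |f₂ Z'| < B := by
      refine ⟨∑ Z, |f₁ Z| + ∑ Z, |f₂ Z| + 1, fun Z Z' => ?_⟩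
      have h1 := Finset.single_le_sum (f := fun Z => |f₁ Z|) (fun _ _ => abs_nonneg _)
        (Finset.mem_univ Z)
      have h2 := Finset.single_le_sum (f := fun Z => |f₂ Z|) (fun _ _ => abs_nonneg _)
        (Finset.mem_univ Z')
      omega
    have hB' : ∀ Z Z', f₁ Z - 2 * B < f₂ Z' ∧ f₂ Z' < f₁ Z + 2 * B := by
      intro Z Z'
      have h1 := hB Z Z'
      have h2 := abs_le.1 (le_refl |f₁ Z|)
      have h3 := abs_le.1 (le_refl |f₂ Z'|)
      have h4 := abs_nonneg (f₁ Z)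
      have h5 := abs_nonneg (f₂ Z')
      constructor <;> omega
    classical
    -- with `m` in the packet: the faces `Z` with `T (insert m Z)` come after those containing `m`
    have htop : ∀ (C : Finset (Fin n)) (x : Fin n), C ⊆ S₁ → x ∈ S₁ → x ∉ C →
        insert x C ∈ Inv w (k + 1) → insert m C ∈ Inv w (k + 1) →
        T (insert m (insert x C)) → insert x C ⊆ M := by
      intro C x hC hx hxC hCx hCm hTm
      have hmC : m ∉ C := fun h => hmS₁ (hC h)
      refine Finset.insert_subset (Finset.mem_filter.2 ⟨hx, ?_⟩) fun c hc =>
        Finset.mem_filter.2 ⟨hC hc, (mem_Inv.1 hCm).2 c (by simp [hc]) m (by simp) (hlt c (hC hc))⟩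
      by_contra hcon
      have := (hp C x m (hC.trans hS₁S) (hS₁S hx) hmS (hlt x hx)
        (not_inv_trans (hlt x hx).ne hcon) hxC hmC hCx hCm).1
        (by rwa [Finset.insert_comm])
      -- No entry of `C` exceeds `m`, so the parity is that of `ε`, which is even.
      have h0 : (C.filter fun z => m < z) = ∅ :=
        Finset.filter_eq_empty_iff.2 fun c hc => (hlt c (hC hc)).asymm
      rw [h0, Finset.card_empty, zero_add] at this
      exact (Nat.not_odd_iff_even.2 hε) this
    -- these faces form an upper set
    have hup : ∀ (C : Finset (Fin n)) (x y : Fin n), C ⊆ S₁ → x ∈ S₁ → y ∈ S₁ → x ≠ y → x ∉ C →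
        y ∉ C → insert x C ∈ Inv w (k + 1) → insert y C ∈ Inv w (k + 1) →
        (x < y → ¬ T (insert x (insert y C))) → (y < x → T (insert y (insert x C))) →
        (insert x C ⊆ M ∧ T (insert m (insert x C))) →
        (insert y C ⊆ M ∧ T (insert m (insert y C))) := by
      intro C x y hC hx hy hne hxC hyC hCx hCy h1 h2 ⟨hxM, hxT⟩
      have hmC : m ∉ C := fun h => hmS₁ (hC h)
      have hCm : insert m C ∈ Inv w (k + 1) := by
        refine hinsM ((Finset.subset_insert _ _).trans hxM) ?_
        have := erase_mem_Inv hCx (x := x) (by simp)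
        rwa [Finset.erase_insert hxC] at this
      have hTy : T (insert m (insert y C)) := by
        rw [Finset.insert_comm] at hxT ⊢
        rcases lt_or_gt_of_ne hne with e | e
        · by_contra hcon
          exact (hT C x y m (hC.trans hS₁S) (hS₁S hx) (hS₁S hy) hmS e (hlt y hy) hxC hyC hmC
            hCx hCy hCm).2 (h1 e) hcon hxT
        · exact (hT C y x m (hC.trans hS₁S) (hS₁S hy) (hS₁S hx) hmS e (hlt x hx) hyC hxC hmC
            hCy hCx hCm).1 (h2 e) hxT
      exact ⟨htop C y hC hy hyC hCy hCm hTy, hTy⟩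
    -- Three layers: sets avoiding `m` and unflipped against it, sets containing `m`, sets avoiding
    -- `m` and flipped against it.
    let f : Finset (Fin n) → ℤ := fun Z =>
      if m ∈ Z then f₂ (Z.erase m) else
        if Z ⊆ M ∧ T (insert m Z) then f₁ Z + 2 * B else f₁ Z - 2 * B
    refine ⟨f, ?_⟩
    intro C x y hC hx hy hxy hxC hyC hCx hCy
    have hB0 : 0 < B := lt_of_le_of_lt
      (add_nonneg (abs_nonneg (f₁ ∅)) (abs_nonneg (f₂ ∅))) (hB ∅ ∅)
    have hxm : x ≠ m := fun e => absurd (hmax y hy) (not_le.2 (e ▸ hxy))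
    have hxS₁ : x ∈ S₁ := Finset.mem_erase.2 ⟨hxm, hx⟩
    by_cases hmC : m ∈ C
    · obtain ⟨D, hmD, rfl⟩ : ∃ D, m ∉ D ∧ insert m D = C :=
        ⟨C.erase m, by simp, Finset.insert_erase hmC⟩
      simp only [Finset.mem_insert, not_or] at hxC hyC
      have hyS₁ : y ∈ S₁ := Finset.mem_erase.2 ⟨hyC.1, hy⟩
      have hDS₁ : D ⊆ S₁ := fun d hd =>
        Finset.mem_erase.2 ⟨fun e => hmD (e ▸ hd), hC (by simp [hd])⟩
      have hmem : ∀ z ∈ S₁, insert z (insert m D) ∈ Inv w (k + 1) → insert z D ⊆ M := by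
        intro z hz hzi d hd
        have hd' : d ∈ S₁ := by
          rcases Finset.mem_insert.1 hd with rfl | h
          · exact hz
          · exact hDS₁ h
        refine Finset.mem_filter.2 ⟨hd', (mem_Inv.1 hzi).2 d ?_ m (by simp) (hlt d hd')⟩
        rw [Finset.insert_comm]; exact Finset.mem_insert_of_mem hd
      have hxM := hmem x hxS₁ hCx
      have hyM := hmem y hyS₁ hCy
      have hx1 := erase_mem_Inv hCx (x := m) (by simp)
      have hy1 := erase_mem_Inv hCy (x := m) (by simp)
      rw [erase_insert_insert_right hxC.1 hmD] at hx1
      rw [erase_insert_insert_right hyC.1 hmD] at hy1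
      have := hf₂ D x y ((Finset.subset_insert _ _).trans hxM) (hxM (by simp)) (hyM (by simp)) hxy
        hxC.2 hyC.2 hx1 hy1
      simp only [hcomm] at this
      simp only [f]
      rw [if_pos (by simp), if_pos (by simp), erase_insert_insert_right hxC.1 hmD,
        erase_insert_insert_right hyC.1 hmD]
      exact this
    · have hCS₁ : C ⊆ S₁ := fun c hc => Finset.mem_erase.2 ⟨fun e => hmC (e ▸ hc), hC hc⟩
      have hmx : m ∉ insert x C := by simp [hmC, hxm.symm]
      by_cases hym : y = m
      · rw [hym] at hCy ⊢
        have hfm : f (insert m C) = f₂ ((insert m C).erase m) := if_pos (by simp)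
        rw [hfm]
        simp only [f]
        rw [if_neg hmx]
        constructor
        · intro h
          rw [if_neg (fun h' => h (by rw [Finset.insert_comm]; exact h'.2))]
          exact (hB' _ _).1
        · intro h
          rw [Finset.insert_comm] at h
          rw [if_pos ⟨htop C x hCS₁ hxS₁ hxC hCx hCy h, h⟩]
          exact (hB' _ _).2
      · have hyS₁ : y ∈ S₁ := Finset.mem_erase.2 ⟨hym, hy⟩
        have hmy : m ∉ insert y C := by simp [hmC, Ne.symm hym]
        have h1 := hf₁ C x y hCS₁ hxS₁ hyS₁ hxy hxC hyC hCx hCy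
        simp only [f]
        rw [if_neg hmx, if_neg hmy]
        constructor
        · intro h
          have h2 := hup C x y hCS₁ hxS₁ hyS₁ hxy.ne hxC hyC hCx hCy (fun _ => h)
            (fun e => absurd e hxy.asymm)
          have h3 := h1.1 h
          split_ifs with h4 h5 h5
          · omega
          · exact absurd (h2 h4) h5
          · omega
          · omega
        · intro h
          have h2 := hup C y x hCS₁ hyS₁ hxS₁ hxy.ne' hyC hxC hCy hCx
            (fun e => absurd e hxy.asymm) (fun _ => h)
          have h3 := h1.2 h
          split_ifs with h4 h5 h5
          · omega
          · exact absurd (h2 h4) h5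
          · omega
          · omega

/-- The relation attached to a consistent set is acyclic. -/
theorem IsConsistent.exists_height {w : Equiv.Perm (Fin n)} {k : ℕ}
    {R : Finset (Finset (Fin n))} (h : IsConsistent w (k + 1) R) :
    ∃ f : Finset (Fin n) → ℤ, ∀ A B, Prec w k (Flipped w R) A B → f A < f B := by
  obtain ⟨f, hf⟩ := exists_height_on w _ Finset.univ k 0 (Flipped w R) le_rfl
    (fun C a b c _ _ _ _ => h.locallyTransitive C a b c)
    (fun C x y _ _ _ hxy hw _ _ hCx hCy => flipped_iff_odd h.subset hxy hw hCx hCy)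
  refine ⟨f, ?_⟩
  rintro A B ⟨C, x, y, hxy, hx, hy, hCx, hCy, h⟩
  have := hf C x y (Finset.subset_univ _) (Finset.mem_univ _) (Finset.mem_univ _) hxy hx hy hCx hCy
  rcases h with ⟨hT, rfl, rfl⟩ | ⟨hT, rfl, rfl⟩
  · exact this.1 hT
  · exact this.2 hT

/-! ### Removing or adding one element of a consistent set -/

/-- Removing from a family `P` of faces of `W` the one `X` that is lowest for `g` among those
containing the largest entry `p` keeps it a prefix or a suffix. -/
theorem pattern_remove {P : Finset (Fin n) → Prop} {g : Finset (Fin n) → ℤ}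
    {W X : Finset (Fin n)} {p : Fin n}
    (hpat : ∀ a ∈ W, ∀ b ∈ W, ∀ c ∈ W, a < b → b < c →
      (P (W.erase a) → P (W.erase c) → P (W.erase b)) ∧
      (¬ P (W.erase a) → ¬ P (W.erase c) → ¬ P (W.erase b)))
    (hmax : ∀ a ∈ W, ∀ b ∈ W, a ≠ b → P (W.erase a) → P (W.erase b) → p ∈ W → ∀ z ∈ W, z ≤ p)
    (hg : ∀ u ∈ W, ∀ v ∈ W, p ∈ W → v < p → u < v →
      (P (W.erase p) → g ((W.erase p).erase u) < g ((W.erase p).erase v)) ∧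
      (¬ P (W.erase p) → g ((W.erase p).erase v) < g ((W.erase p).erase u)))
    (hmin : ∀ u ∈ W, u ≠ p → p ∈ W → P (W.erase u) → g (X.erase p) ≤ g ((W.erase p).erase u))
    (hpX : p ∈ X) (hX : P X) :
    ∀ a ∈ W, ∀ b ∈ W, ∀ c ∈ W, a < b → b < c →
      ((P (W.erase a) ∧ W.erase a ≠ X) → (P (W.erase c) ∧ W.erase c ≠ X) →
        (P (W.erase b) ∧ W.erase b ≠ X)) ∧
      (¬ (P (W.erase a) ∧ W.erase a ≠ X) → ¬ (P (W.erase c) ∧ W.erase c ≠ X) →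
        ¬ (P (W.erase b) ∧ W.erase b ≠ X)) := by
  intro a ha b hb c hc hab hbc
  have hac := hab.trans hbc
  have hpc := hpat a ha b hb c hc hab hbc
  constructor
  · rintro ⟨h1, -⟩ ⟨h2, -⟩
    refine ⟨hpc.1 h1 h2, ?_⟩
    rintro rfl
    have hpW : p ∈ W := Finset.mem_of_mem_erase hpX
    have hle := hmax a ha c hc hac.ne h1 h2 hpW
    have h3 := hmin a ha (hac.trans_le (hle c hc)).ne hpW h1
    rw [Finset.erase_right_comm] at h3
    -- On the faces of `W.erase p` the height increases or decreases with the erased entry according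
    -- to `hP`, so its minimum cannot be attained at the inner entry `b`.
    by_cases hP : P (W.erase p)
    · exact absurd ((hg a ha b hb hpW (hbc.trans_le (hle c hc)) hab).1 hP) (not_lt.2 h3)
    · rcases (hle c hc).eq_or_lt with rfl | h4
      · exact hP h2
      · have h5 := hmin c hc h4.ne hpW h2
        rw [Finset.erase_right_comm] at h5
        exact absurd ((hg b hb c hc hpW h4 hbc).2 hP) (not_lt.2 h5)
  · rintro h1 h2 ⟨h3, h4⟩
    -- A new violation requires `X` to be one of the two outer faces; otherwise the original pattern
    -- applies.
    by_cases haX : W.erase a = X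
    · subst haX
      have hpW : p ∈ W := Finset.mem_of_mem_erase hpX
      have hle := hmax a ha b hb hab.ne hX h3 hpW
      have hcP : ¬ P (W.erase c) := fun h => h2 ⟨h, erase_ne_erase hc hac.ne'⟩
      have h5 := hmin b hb (hbc.trans_le (hle c hc)).ne hpW h3
      rw [Finset.erase_right_comm] at h5
      by_cases hP : P (W.erase p)
      · rcases (hle c hc).eq_or_lt with rfl | h6
        · exact hcP hP
        · exact hcP ((hpat b hb c hc p hpW hbc h6).1 h3 hP)
      · exact absurd ((hg a ha b hb hpW (hbc.trans_le (hle c hc)) hab).2 hP) (not_lt.2 h5)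
    · by_cases hcX : W.erase c = X
      · subst hcX
        have hpW : p ∈ W := Finset.mem_of_mem_erase hpX
        have hle := hmax b hb c hc hbc.ne h3 hX hpW
        have haP : ¬ P (W.erase a) := fun h => h1 ⟨h, haX⟩
        have hcp : c < p := lt_of_le_of_ne (hle c hc) (Finset.ne_of_mem_erase hpX).symm
        have h5 := hmin b hb (hbc.trans hcp).ne hpW h3
        rw [Finset.erase_right_comm] at h5
        by_cases hP : P (W.erase p)
        · exact absurd ((hg b hb c hc hpW hcp hbc).1 hP) (not_lt.2 h5)
        · exact (hpat a ha c hc p hpW hac hcp).2 haP hP hX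
      · exact hpc.2 (fun h => h1 ⟨h, haX⟩) (fun h => h2 ⟨h, hcX⟩) h3

/-- Any two faces of an inversion `Y` are `Prec`-related with the orientation of `Y`, so a height is
strictly monotone or antitone along the packet. -/
theorem height_faces {w : Equiv.Perm (Fin n)} {k : ℕ} {R : Finset (Finset (Fin n))}
    {f : Finset (Fin n) → ℤ} (hf : ∀ A B, Prec w k (Flipped w R) A B → f A < f B)
    {Y : Finset (Fin n)} (hY : Y ∈ Inv w (k + 1)) {u v : Fin n} (hu : u ∈ Y) (hv : v ∈ Y)
    (huv : u < v) :
    (Y ∈ R → f (Y.erase u) < f (Y.erase v)) ∧ (Y ∉ R → f (Y.erase v) < f (Y.erase u)) := by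
  have e1 : insert u ((Y.erase u).erase v) = Y.erase v := by
    rw [Finset.erase_right_comm, Finset.insert_erase (by simp [hu, huv.ne])]
  have e2 : insert v ((Y.erase u).erase v) = Y.erase u := by
    rw [Finset.insert_erase (by simp [hv, huv.ne'])]
  have e3 : insert u (insert v ((Y.erase u).erase v)) = Y := by
    rw [e2, Finset.insert_erase hu]
  have key : ∀ A B, _ → Prec w k (Flipped w R) A B := fun A B hyp =>
    ⟨(Y.erase u).erase v, u, v, huv, by simp, by simp, by rw [e1]; exact erase_mem_Inv hY hv,
      by rw [e2]; exact erase_mem_Inv hY hu, hyp⟩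
  rw [e3, e1, e2, flipped_of_mem_Inv hY] at key
  exact ⟨fun h => hf _ _ (key _ _ (Or.inr ⟨h, rfl, rfl⟩)),
    fun h => hf _ _ (key _ _ (Or.inl ⟨h, rfl, rfl⟩))⟩

/-- Deleting the largest entry from a quasi-inversion relation reverses it. -/
theorem quasiRel_of_insert {w : Equiv.Perm (Fin n)} {k : ℕ} {C : Finset (Fin n)}
    {x y m : Fin n} (hxy : x < y) (hw : w⁻¹ x < w⁻¹ y) (hym : y < m) (hm : m ∉ C)
    (hx : x ∉ C) (hy : y ∉ C) (hCx : insert x (insert m C) ∈ Inv w (k + 1))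
    (hCy : insert y (insert m C) ∈ Inv w (k + 1)) :
    (Even ((insert m C).filter fun z => y < z).card →
      QuasiRel w k (insert y C) (insert x C)) ∧
    (Odd ((insert m C).filter fun z => y < z).card →
      QuasiRel w k (insert x C) (insert y C)) := by
  have hx1 := erase_mem_Inv hCx (x := m) (by simp)
  have hy1 := erase_mem_Inv hCy (x := m) (by simp)
  rw [erase_insert_insert_right (hxy.trans hym).ne hm] at hx1
  rw [erase_insert_insert_right hym.ne hm] at hy1
  rw [Finset.filter_insert, if_pos hym, Finset.card_insert_of_notMem (by simp [hm])]
  refine ⟨fun h => ?_, fun h => ?_⟩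
  · exact quasiRel_iff.2 ⟨C, x, y, hxy, hw, hx, hy, hx1, hy1,
      Or.inr ⟨by simpa [Nat.even_add_one] using h, rfl, rfl⟩⟩
  · exact quasiRel_iff.2 ⟨C, x, y, hxy, hw, hx, hy, hx1, hy1,
      Or.inl ⟨by simpa [Nat.odd_add_one] using h, rfl, rfl⟩⟩

/-- Let `m` be the largest entry occurring in `R`, and among the members containing `m` take the `X`
whose remainder `X.erase m` is lowest. A permanent relation from `X` to another member whose common
face contains `m` reverses on deleting `m`, against minimality; so the ideal property survives. For
packets, `pattern_remove` applies. -/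
theorem IsConsistent.exists_erase {w : Equiv.Perm (Fin n)} {k : ℕ}
    {R : Finset (Finset (Fin n))} (h : IsConsistent w (k + 1) R) (hne : R.Nonempty) :
    ∃ X ∈ R, IsConsistent w (k + 1) (R.erase X) := by
  obtain ⟨f, hf⟩ := h.exists_height
  have hU : (R.biUnion id).Nonempty := by
    obtain ⟨X, hX⟩ := hne
    have : 0 < X.card := by rw [(mem_Inv.1 (h.subset hX)).1]; omega
    obtain ⟨x, hx⟩ := Finset.card_pos.1 this
    exact ⟨x, Finset.mem_biUnion.2 ⟨X, hX, hx⟩⟩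
  obtain ⟨m, hm, hmax⟩ := Finset.exists_max_image _ id hU
  have hmax' : ∀ A ∈ R, ∀ z ∈ A, z ≤ m := fun A hA z hz =>
    hmax z (Finset.mem_biUnion.2 ⟨A, hA, hz⟩)
  have hV : (R.filter fun A => m ∈ A).Nonempty := by
    obtain ⟨A, hA, hmA⟩ := Finset.mem_biUnion.1 hm
    exact ⟨A, Finset.mem_filter.2 ⟨hA, hmA⟩⟩
  obtain ⟨X, hX, hmin⟩ := Finset.exists_min_image _ (fun A => f (A.erase m)) hV
  rw [Finset.mem_filter] at hX
  have hmin' : ∀ A ∈ R, m ∈ A → f (X.erase m) ≤ f (A.erase m) := fun A hA hmA =>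
    hmin A (Finset.mem_filter.2 ⟨hA, hmA⟩)
  obtain ⟨hXR, hmX⟩ := hX
  refine ⟨X, hXR, .of_quasiRel ((Finset.erase_subset _ _).trans h.subset) ?_ ?_⟩
  · intro A B hAB hB
    rw [Finset.mem_erase] at hB ⊢
    refine ⟨?_, h.mem_of_quasiRel hAB hB.2⟩
    rintro rfl
    obtain ⟨D, x, y, hxy, hw, hx, hy, hDx, hDy, hyp⟩ := quasiRel_iff.1 hAB
    have hym : y ≤ m := by
      rcases hyp with ⟨-, -, e⟩ | ⟨-, e, -⟩
      · exact hmax' B hB.2 y (by simp [e])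
      · exact hmax' A hXR y (by simp [e])
    by_cases hmD : m ∈ D
    · obtain ⟨C, hmC, rfl⟩ : ∃ C, m ∉ C ∧ insert m C = D :=
        ⟨D.erase m, by simp, Finset.insert_erase hmD⟩
      simp only [Finset.mem_insert, not_or] at hx hy
      have hq := quasiRel_of_insert hxy hw (lt_of_le_of_ne hym hy.1) hmC hx.2 hy.2 hDx hDy
      rcases hyp with ⟨hp, rfl, rfl⟩ | ⟨hp, rfl, rfl⟩
      · have h1 := hf _ _ (quasiRel_prec h.subset (hq.1 hp))
        have h2 := hmin' _ hB.2 (by simp)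
        rw [erase_insert_insert_right hx.1 hmC, erase_insert_insert_right hy.1 hmC] at h2
        exact absurd h1 (not_lt.2 h2)
      · have h1 := hf _ _ (quasiRel_prec h.subset (hq.2 hp))
        have h2 := hmin' _ hB.2 (by simp)
        rw [erase_insert_insert_right hx.1 hmC, erase_insert_insert_right hy.1 hmC] at h2
        exact absurd h1 (not_lt.2 h2)
    · rcases hyp with ⟨hp, rfl, rfl⟩ | ⟨hp, rfl, rfl⟩
      · have : m = x := by simpa [hmD] using hmX
        exact absurd hym (not_le.2 (this ▸ hxy))
      · have : m = y := by simpa [hmD] using hmX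
        subst this
        -- The non-inverted pair ends in the largest entry, so the parity is even, contrary to `hp`.
        have h0 : (D.filter fun z => m < z) = ∅ :=
          Finset.filter_eq_empty_iff.2 fun z hz => not_lt.2 (hmax' _ hXR z (by simp [hz]))
        rw [h0] at hp
        simp at hp
  · intro W hW
    have := pattern_remove (P := fun A => A ∈ R) (g := f) (W := W) (X := X) (p := m)
      (isPrefixOf_or_isSuffixOf_iff.1 (h.msz W hW)) ?_ ?_ ?_ hmX hXR
    · simpa only [Finset.mem_erase, and_comm] using this
    · intro a ha b hb hab h1 h2 _ z hz
      by_cases hza : z = a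
      · exact hmax' _ h2 z (by simp [hza, hab, ha])
      · exact hmax' _ h1 z (by simp [hz, hza])
    · intro u hu v hv hmW hvm huv
      exact height_faces hf (erase_mem_Inv hW hmW) (by simp [hu, (huv.trans hvm).ne])
        (by simp [hv, hvm.ne]) huv
    · intro u hu hum hmW huR
      rw [Finset.erase_right_comm]
      exact hmin' _ huR (by simp [hmW, hum.symm])

/-- Dual to removal, applied to the complement of `R` with the height negated. The distinguished
entry `p` is now chosen by position instead of value: it has the smallest `w⁻¹` among the entries of
missing inversions. It is still the largest entry of every missing inversion containing it, and it
cannot be the larger entry of a non-inverted pair whose smaller entry lies in a missing inversion.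
-/
theorem IsConsistent.exists_insert {w : Equiv.Perm (Fin n)} {k : ℕ}
    {R : Finset (Finset (Fin n))} (h : IsConsistent w (k + 1) R) (hne : R ≠ Inv w (k + 1)) :
    ∃ X ∉ R, IsConsistent w (k + 1) (insert X R) := by
  obtain ⟨f, hf⟩ := h.exists_height
  have hU : ((Inv w (k + 1) \ R).biUnion id).Nonempty := by
    obtain ⟨X, hX⟩ : (Inv w (k + 1) \ R).Nonempty := by
      rw [Finset.sdiff_nonempty]
      exact fun h' => hne (h.subset.antisymm h')
    have : 0 < X.card := by rw [(mem_Inv.1 (Finset.mem_sdiff.1 hX).1).1]; omega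
    obtain ⟨x, hx⟩ := Finset.card_pos.1 this
    exact ⟨x, Finset.mem_biUnion.2 ⟨X, hX, hx⟩⟩
  obtain ⟨p, hp, hpos⟩ := Finset.exists_min_image _ (fun z => w⁻¹ z) hU
  have hpos' : ∀ A ∈ Inv w (k + 1), A ∉ R → ∀ z ∈ A, w⁻¹ p ≤ w⁻¹ z := fun A hA hA' z hz =>
    hpos z (Finset.mem_biUnion.2 ⟨A, Finset.mem_sdiff.2 ⟨hA, hA'⟩, hz⟩)
  have hV : ((Inv w (k + 1) \ R).filter fun A => p ∈ A).Nonempty := by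
    obtain ⟨A, hA, hpA⟩ := Finset.mem_biUnion.1 hp
    exact ⟨A, Finset.mem_filter.2 ⟨hA, hpA⟩⟩
  obtain ⟨X, hX, hmax⟩ := Finset.exists_max_image _ (fun A => f (A.erase p)) hV
  rw [Finset.mem_filter, Finset.mem_sdiff] at hX
  have hmax' : ∀ A ∈ Inv w (k + 1), A ∉ R → p ∈ A → f (A.erase p) ≤ f (X.erase p) :=
    fun A hA hA' hpA => hmax A (Finset.mem_filter.2 ⟨Finset.mem_sdiff.2 ⟨hA, hA'⟩, hpA⟩)
  obtain ⟨⟨hXI, hXR⟩, hpX⟩ := hX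
  have hlast : ∀ {j : ℕ} {A : Finset (Fin n)}, A ∈ Inv w j → p ∈ A →
      (∀ z ∈ A, w⁻¹ p ≤ w⁻¹ z) → ∀ z ∈ A, z ≤ p := by
    intro j A hA hpA hA' z hz
    by_contra hcon
    exact absurd ((mem_Inv.1 hA).2 p hpA z hz (not_le.1 hcon)) (not_lt.2 (hA' z hz))
  refine ⟨X, hXR, .of_quasiRel (Finset.insert_subset hXI h.subset) ?_ ?_⟩
  · intro A B hAB hB
    rw [Finset.mem_insert] at hB ⊢
    rcases hB with rfl | hB
    · by_contra hcon
      push Not at hcon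
      obtain ⟨-, hAR⟩ := hcon
      have hAI := hAB.mem_Inv.1
      obtain ⟨D, x, y, hxy, hw, hx, hy, hDx, hDy, hyp⟩ := quasiRel_iff.1 hAB
      by_cases hpD : p ∈ D
      · obtain ⟨C, hpC, rfl⟩ : ∃ C, p ∉ C ∧ insert p C = D :=
          ⟨D.erase p, by simp, Finset.insert_erase hpD⟩
        simp only [Finset.mem_insert, not_or] at hx hy
        have hyp' : y ≤ p := by
          rcases hyp with ⟨-, -, e⟩ | ⟨-, e, -⟩
          · exact hlast hXI hpX (hpos' _ hXI hXR) y (by simp [e])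
          · exact hlast hAI (by simp [e]) (hpos' _ hAI hAR) y (by simp [e])
        have hq := quasiRel_of_insert hxy hw (lt_of_le_of_ne hyp' hy.1) hpC hx.2 hy.2 hDx hDy
        rcases hyp with ⟨hp, rfl, rfl⟩ | ⟨hp, rfl, rfl⟩
        · have h1 := hf _ _ (quasiRel_prec h.subset (hq.1 hp))
          have h2 := hmax' _ hAI hAR (by simp)
          rw [erase_insert_insert_right hx.1 hpC, erase_insert_insert_right hy.1 hpC] at h2
          exact absurd h1 (not_lt.2 h2)
        · have h1 := hf _ _ (quasiRel_prec h.subset (hq.2 hp))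
          have h2 := hmax' _ hAI hAR (by simp)
          rw [erase_insert_insert_right hx.1 hpC, erase_insert_insert_right hy.1 hpC] at h2
          exact absurd h1 (not_lt.2 h2)
      · rcases hyp with ⟨hp, rfl, rfl⟩ | ⟨hp, rfl, rfl⟩
        · have : p = y := by simpa [hpD] using hpX
          exact absurd (hpos' _ hAI hAR x (by simp)) (not_le.2 (this ▸ hw))
        · have : p = x := by simpa [hpD] using hpX
          subst this
          have h0 : (D.filter fun z => y < z) = ∅ := by
            refine Finset.filter_eq_empty_iff.2 fun z hz hyz => ?_
            exact absurd (hlast hXI hpX (hpos' _ hXI hXR) z (by simp [hz]))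
              (not_le.2 (hxy.trans hyz))
          rw [h0] at hp
          simp at hp
    · exact Or.inr (h.mem_of_quasiRel hAB hB)
  · intro W hW a ha b hb c hc hab hbc
    have := pattern_remove (P := fun A => A ∉ R) (g := fun A => - f A) (W := W) (X := X) (p := p)
      ?_ ?_ ?_ ?_ hpX hXR a ha b hb c hc hab hbc
    · have e : ∀ A, A ∈ insert X R ↔ ¬ (A ∉ R ∧ A ≠ X) := fun A => by
        rw [Finset.mem_insert, not_and_or, not_not, not_not, or_comm]
      simp only [e, not_not]
      exact ⟨this.2, this.1⟩
    · intro a ha b hb c hc hab hbc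
      have := isPrefixOf_or_isSuffixOf_iff.1 (h.msz W hW) a ha b hb c hc hab hbc
      exact ⟨this.2, by simpa using this.1⟩
    · intro a ha b hb hab h1 h2 hpW
      refine hlast hW hpW fun z hz => ?_
      by_cases hza : z = a
      · exact hpos' _ (erase_mem_Inv hW hb) h2 z (by simp [hza, hab, ha])
      · exact hpos' _ (erase_mem_Inv hW ha) h1 z (by simp [hz, hza])
    · intro u hu v hv hpW hvp huv
      have := height_faces hf (erase_mem_Inv hW hpW) (u := u) (v := v)
        (by simp [hu, (huv.trans hvp).ne]) (by simp [hv, hvp.ne]) huv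
      simp only [neg_lt_neg_iff, not_not]
      exact ⟨this.2, this.1⟩
    · intro u hu hup hpW huR
      rw [Finset.erase_right_comm, neg_le_neg_iff]
      exact hmax' _ (erase_mem_Inv hW hu) huR (by simp [hpW, hup.symm])

end HigherBruhat

/-! ### Admissible orders as linear extensions -/

namespace HigherBruhat
variable {n : ℕ}

theorem pairwise_idxOf {α : Type*} [DecidableEq α] {l : List α} (h : l.Nodup) :
    l.Pairwise fun a b => l.idxOf a < l.idxOf b := by
  rw [List.pairwise_iff_getElem]
  intro i j hi hj hij
  rwa [h.idxOf_getElem i hi, h.idxOf_getElem j hj]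

theorem rel_of_idxOf_lt {α : Type*} [DecidableEq α] {l : List α} {r : α → α → Prop}
    (h : l.Pairwise r) {a b : α} (hb : b ∈ l) (hab : l.idxOf a < l.idxOf b) :
    r a b := by
  have hb' := List.idxOf_lt_length_of_mem hb
  have := List.pairwise_iff_getElem.1 h _ _ (hab.trans hb') hb' hab
  rwa [List.getElem_idxOf, List.getElem_idxOf] at this

theorem antilex_rel {X : Finset (Fin n)} {r : Finset (Fin n) → Finset (Fin n) → Prop}
    (h : (antilex X).Pairwise r) {x y : Fin n} (hx : x ∈ X) (hy : y ∈ X) (hxy : x < y) :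
    r (X.erase x) (X.erase y) := by
  rw [antilex_eq, List.pairwise_map] at h
  have hs := (Finset.sortedLT_sort X).pairwise
  refine rel_of_idxOf_lt h ((Finset.mem_sort _).2 hy) ?_
  by_contra hcon
  rcases (not_lt.1 hcon).eq_or_lt with e | e
  · rw [List.idxOf_inj ((Finset.mem_sort _).2 hy)] at e
    exact hxy.ne' e
  · exact hxy.asymm (rel_of_idxOf_lt hs ((Finset.mem_sort _).2 hx) e)

theorem perm_filter_packet {ρ : List (Finset (Fin n))} (h : ρ.Nodup) {X : Finset (Fin n)}
    (hX : ∀ x ∈ X, X.erase x ∈ ρ) : (ρ.filter fun Y => Y ∈ packet X).Perm (antilex X) := by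
  rw [List.perm_ext_iff_of_nodup (h.filter _) (nodup_antilex X)]
  intro A
  rw [mem_antilex, List.mem_filter, decide_eq_true_iff]
  refine ⟨fun h => h.2, fun h => ⟨?_, h⟩⟩
  obtain ⟨x, hx, rfl⟩ := mem_packet.1 h
  exact hX x hx

theorem filter_eq_antilex_iff {ρ : List (Finset (Fin n))} (h : ρ.Nodup) {X : Finset (Fin n)}
    (hX : ∀ x ∈ X, X.erase x ∈ ρ) : (ρ.filter fun Y => Y ∈ packet X) = antilex X ↔
      ∀ x ∈ X, ∀ y ∈ X, x < y → ρ.idxOf (X.erase x) < ρ.idxOf (X.erase y) := by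
  have hp := (pairwise_idxOf h).filter (fun Y => Y ∈ packet X)
  constructor
  · intro e x hx y hy hxy
    rw [e] at hp
    exact antilex_rel hp hx hy hxy
  · intro hlt
    refine (perm_filter_packet h hX).eq_of_pairwise (fun a b _ _ h1 h2 => ?_) hp ?_
    · exact absurd h1 h2.asymm
    · refine (pairwise_antilex X).imp ?_
      rintro A B ⟨x, hx, y, hy, hxy, rfl, rfl⟩
      exact hlt x hx y hy hxy

theorem filter_eq_lex_iff {ρ : List (Finset (Fin n))} (h : ρ.Nodup) {X : Finset (Fin n)}
    (hX : ∀ x ∈ X, X.erase x ∈ ρ) : (ρ.filter fun Y => Y ∈ packet X) = lex X ↔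
      ∀ x ∈ X, ∀ y ∈ X, x < y → ρ.idxOf (X.erase y) < ρ.idxOf (X.erase x) := by
  have hp := (pairwise_idxOf h).filter (fun Y => Y ∈ packet X)
  constructor
  · intro e x hx y hy hxy
    rw [e, lex, List.pairwise_reverse] at hp
    exact antilex_rel hp hx hy hxy
  · intro hlt
    refine ((perm_filter_packet h hX).trans (List.reverse_perm _).symm).eq_of_pairwise
      (fun a b _ _ h1 h2 => ?_) hp ?_
    · exact absurd h1 h2.asymm
    · rw [lex, List.pairwise_reverse]
      refine (pairwise_antilex X).imp ?_
      rintro A B ⟨x, hx, y, hy, hxy, rfl, rfl⟩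
      exact hlt x hx y hy hxy

/-- This is where `k > 0` enters the recovery of `R` from an order: on a one-element packet lex and
antilex coincide. -/
theorem antilex_ne_lex {X : Finset (Fin n)} (hX : 1 < X.card) : antilex X ≠ lex X := by
  intro e
  obtain ⟨x, hx, y, hy, hne⟩ := Finset.one_lt_card.1 hX
  wlog hxy : x < y generalizing x y
  · exact this y hy x hx hne.symm (lt_of_le_of_ne (not_lt.1 hxy) hne.symm)
  have h := pairwise_idxOf (nodup_antilex X)
  have h1 := antilex_rel h hx hy hxy
  have h2 : (lex X).Pairwise fun a b => (antilex X).idxOf a < (antilex X).idxOf b := by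
    rw [← e]; exact h
  rw [lex, List.pairwise_reverse] at h2
  exact h1.asymm (antilex_rel h2 hx hy hxy)

/-- `ρ` is a total order of `Inv w k` that orients packets as prescribed by `R`. -/
structure IsLinExt (w : Equiv.Perm (Fin n)) (k : ℕ) (R : Finset (Finset (Fin n)))
    (ρ : List (Finset (Fin n))) : Prop where
  nodup : ρ.Nodup
  mem_iff : ∀ X, X ∈ ρ ↔ X ∈ Inv w k
  pairwise : ρ.Pairwise fun A B => ¬ Prec w k (Flipped w R) B A

variable {w : Equiv.Perm (Fin n)} {k : ℕ}

theorem Prec.mem_Inv {T : Finset (Fin n) → Prop} {A B : Finset (Fin n)} (h : Prec w k T A B) :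
    A ∈ Inv w k ∧ B ∈ Inv w k := by
  obtain ⟨C, x, y, -, -, -, hCx, hCy, ⟨-, rfl, rfl⟩ | ⟨-, rfl, rfl⟩⟩ := h
  · exact ⟨hCx, hCy⟩
  · exact ⟨hCy, hCx⟩

theorem insert_ne_insert {C : Finset (Fin n)} {x y : Fin n} (hxy : x ≠ y) (hx : x ∉ C) :
    insert x C ≠ insert y C := by
  intro e
  have : x ∈ insert y C := e ▸ Finset.mem_insert_self x C
  simp [hxy, hx] at this

theorem Prec.ne {T : Finset (Fin n) → Prop} {A B : Finset (Fin n)} (h : Prec w k T A B) :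
    A ≠ B := by
  obtain ⟨C, x, y, hxy, hx, hy, -, -, ⟨-, rfl, rfl⟩ | ⟨-, rfl, rfl⟩⟩ := h
  · exact insert_ne_insert hxy.ne hx
  · exact insert_ne_insert hxy.ne' hy

/-- Two distinct members of a packet are comparable. -/
theorem prec_or_prec (T : Finset (Fin n) → Prop) {Z A B : Finset (Fin n)} (hA : A ∈ Inv w k)
    (hB : B ∈ Inv w k) (hAZ : A ∈ packet Z) (hBZ : B ∈ packet Z) (hne : A ≠ B) :
    Prec w k T A B ∨ Prec w k T B A := by
  obtain ⟨x, hx, rfl⟩ := mem_packet.1 hAZ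
  obtain ⟨y, hy, rfl⟩ := mem_packet.1 hBZ
  have hxy : x ≠ y := fun e => hne (by rw [e])
  have e1 : insert x ((Z.erase x).erase y) = Z.erase y := by
    rw [Finset.erase_right_comm, Finset.insert_erase (by simp [hx, hxy])]
  have e2 : insert y ((Z.erase x).erase y) = Z.erase x := by
    rw [Finset.insert_erase (by simp [hy, hxy.symm])]
  have i1 : insert x ((Z.erase x).erase y) ∈ Inv w k := by rwa [e1]
  have i2 : insert y ((Z.erase x).erase y) ∈ Inv w k := by rwa [e2]
  rcases lt_or_gt_of_ne hxy with h | h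
  · by_cases hT : T (insert x (insert y ((Z.erase x).erase y)))
    · exact Or.inl ⟨_, x, y, h, by simp, by simp, i1, i2, Or.inr ⟨hT, e2.symm, e1.symm⟩⟩
    · exact Or.inr ⟨_, x, y, h, by simp, by simp, i1, i2, Or.inl ⟨hT, e1.symm, e2.symm⟩⟩
  · by_cases hT : T (insert y (insert x ((Z.erase x).erase y)))
    · exact Or.inr ⟨_, y, x, h, by simp, by simp, i2, i1, Or.inr ⟨hT, e1.symm, e2.symm⟩⟩
    · exact Or.inl ⟨_, y, x, h, by simp, by simp, i2, i1, Or.inl ⟨hT, e2.symm, e1.symm⟩⟩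

/-- Related elements have a common packet. -/
theorem Prec.exists_packet {T : Finset (Fin n) → Prop} {A B : Finset (Fin n)}
    (h : Prec w k T A B) :
    ∃ Z : Finset (Fin n), Z.card = k + 1 ∧ A ∈ packet Z ∧ B ∈ packet Z := by
  obtain ⟨C, x, y, hxy, hx, hy, hCx, hCy, h⟩ := h
  refine ⟨insert x (insert y C), card_insert_insert hxy.ne hx hCy, ?_⟩
  have h1 : insert x C ∈ packet (insert x (insert y C)) :=
    mem_packet.2 ⟨y, by simp, (erase_insert_insert_right hxy.ne hy).symm⟩
  have h2 : insert y C ∈ packet (insert x (insert y C)) :=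
    mem_packet.2 ⟨x, by simp, (erase_insert_insert_left hxy.ne hx).symm⟩
  rcases h with ⟨-, rfl, rfl⟩ | ⟨-, rfl, rfl⟩
  · exact ⟨h1, h2⟩
  · exact ⟨h2, h1⟩

theorem IsLinExt.idxOf_lt {R : Finset (Finset (Fin n))} {ρ : List (Finset (Fin n))}
    (h : IsLinExt w k R ρ) {A B : Finset (Fin n)} (hAB : Prec w k (Flipped w R) A B) :
    ρ.idxOf A < ρ.idxOf B := by
  by_contra hcon
  rcases (not_lt.1 hcon).eq_or_lt with e | e
  · rw [List.idxOf_inj ((h.mem_iff _).2 hAB.mem_Inv.2)] at e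
    exact hAB.ne e.symm
  · exact rel_of_idxOf_lt h.pairwise ((h.mem_iff _).2 hAB.mem_Inv.1) e hAB

theorem IsLinExt.of_idxOf {R : Finset (Finset (Fin n))} {ρ : List (Finset (Fin n))}
    (h1 : ρ.Nodup) (h2 : ∀ X, X ∈ ρ ↔ X ∈ Inv w k)
    (h : ∀ A B, Prec w k (Flipped w R) A B → ρ.idxOf A < ρ.idxOf B) : IsLinExt w k R ρ :=
  ⟨h1, h2, (pairwise_idxOf h1).imp fun hlt hp => hlt.asymm (h _ _ hp)⟩

theorem IsLinExt.idxOf_erase {R : Finset (Finset (Fin n))} {ρ : List (Finset (Fin n))}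
    (h : IsLinExt w k R ρ) {X : Finset (Fin n)} (hX : X ∈ Inv w (k + 1)) {x y : Fin n}
    (hx : x ∈ X) (hy : y ∈ X) (hxy : x < y) :
    (X ∈ R → ρ.idxOf (X.erase x) < ρ.idxOf (X.erase y)) ∧
    (X ∉ R → ρ.idxOf (X.erase y) < ρ.idxOf (X.erase x)) := by
  have := height_faces (f := fun A => (ρ.idxOf A : ℤ)) (R := R)
    (fun A B hAB => Nat.cast_lt.2 (h.idxOf_lt hAB)) hX hx hy hxy
  simpa only [Nat.cast_lt] using this

theorem IsLinExt.erase_mem {R : Finset (Finset (Fin n))} {ρ : List (Finset (Fin n))}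
    (h : IsLinExt w k R ρ) {X : Finset (Fin n)} (hX : X ∈ Inv w (k + 1)) :
    ∀ x ∈ X, X.erase x ∈ ρ :=
  fun _ hx => (h.mem_iff _).2 (erase_mem_Inv hX hx)

theorem IsLinExt.filter_eq {R : Finset (Finset (Fin n))} {ρ : List (Finset (Fin n))}
    (h : IsLinExt w k R ρ) {X : Finset (Fin n)} (hX : X ∈ Inv w (k + 1)) :
    (X ∈ R → (ρ.filter fun Y => Y ∈ packet X) = antilex X) ∧
    (X ∉ R → (ρ.filter fun Y => Y ∈ packet X) = lex X) := by
  rw [filter_eq_antilex_iff h.nodup (h.erase_mem hX), filter_eq_lex_iff h.nodup (h.erase_mem hX)]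
  exact ⟨fun hR x hx y hy hxy => (h.idxOf_erase hX hx hy hxy).1 hR,
    fun hR x hx y hy hxy => (h.idxOf_erase hX hx hy hxy).2 hR⟩

theorem IsLinExt.rev_eq (hk : 0 < k) {R : Finset (Finset (Fin n))} {ρ : List (Finset (Fin n))}
    (hR : R ⊆ Inv w (k + 1)) (h : IsLinExt w k R ρ) : Rev w k ρ = R := by
  ext X
  rw [Rev, Finset.mem_filter]
  constructor
  · rintro ⟨hX, he⟩
    by_contra hXR
    rw [(h.filter_eq hX).2 hXR] at he
    exact antilex_ne_lex (by rw [(HigherBruhat.mem_Inv.1 hX).1]; omega) he.symm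
  · exact fun hX => ⟨hR hX, (h.filter_eq (hR hX)).1 hX⟩

theorem IsLinExt.isAdmissible {R : Finset (Finset (Fin n))} {ρ : List (Finset (Fin n))}
    (hR : R ⊆ Inv w (k + 1)) (h : IsLinExt w k R ρ) : IsAdmissible w k ρ where
  nodup := h.nodup
  mem_iff := h.mem_iff
  linearExtension := by
    intro X _ Y _ hXY
    induction (show Relation.ReflTransGen (QuasiRel w k) X Y from hXY) with
    | refl => exact le_rfl
    | tail h1 h2 ih =>
      exact (ih h2.mem_Inv.1 h1).trans (h.idxOf_lt (quasiRel_prec hR h2)).le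
  restrict := by
    intro X hX
    by_cases hXR : X ∈ R
    · exact Or.inr ((h.filter_eq hX).1 hXR)
    · exact Or.inl ((h.filter_eq hX).2 hXR)

theorem rev_subset (ρ : List (Finset (Fin n))) : Rev w k ρ ⊆ Inv w (k + 1) :=
  Finset.filter_subset _ _

/-- The two sources of relations match the two conditions on an admissible order: extension of the
permanent poset, and lex or antilex restriction to packets. -/
theorem prec_flipped_cases {j : ℕ} {R : Finset (Finset (Fin n))} (hR : R ⊆ Inv w j)
    {A B : Finset (Fin n)} (h : Prec w k (Flipped w R) A B) :
    QuasiRel w k A B ∨ ∃ X ∈ Inv w (k + 1), ∃ x ∈ X, ∃ y ∈ X, x < y ∧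
      ((X ∈ R ∧ A = X.erase x ∧ B = X.erase y) ∨ (X ∉ R ∧ A = X.erase y ∧ B = X.erase x)) := by
  obtain ⟨C, x, y, hxy, hx, hy, hCx, hCy, h⟩ := h
  by_cases hw : w⁻¹ x < w⁻¹ y
  · left
    rw [flipped_iff_odd hR hxy hw hCx hCy, Nat.not_odd_iff_even] at h
    exact quasiRel_iff.2 ⟨C, x, y, hxy, hw, hx, hy, hCx, hCy, h⟩
  · right
    have hX := insert_insert_mem_Inv hxy hw hx hCx hCy
    rw [flipped_of_mem_Inv hX] at h
    refine ⟨_, hX, x, by simp, y, by simp, hxy, ?_⟩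
    rw [erase_insert_insert_left hxy.ne hx, erase_insert_insert_right hxy.ne hy]
    exact h.symm

theorem IsAdmissible.isLinExt {ρ : List (Finset (Fin n))} (h : IsAdmissible w k ρ) :
    IsLinExt w k (Rev w k ρ) ρ := by
  refine .of_idxOf h.nodup h.mem_iff fun A B hAB => ?_
  rcases prec_flipped_cases (rev_subset ρ) hAB with hq | ⟨X, hX, x, hx, y, hy, hxy, hyp⟩
  · refine lt_of_le_of_ne (h.linearExtension A hq.mem_Inv.1 B hq.mem_Inv.2
      (Relation.ReflTransGen.single hq)) fun e => ?_
    rw [List.idxOf_inj ((h.mem_iff _).2 hq.mem_Inv.1)] at e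
    exact hAB.ne e
  · have hm : ∀ x ∈ X, X.erase x ∈ ρ := fun x hx => (h.mem_iff _).2 (erase_mem_Inv hX hx)
    rcases hyp with ⟨hR, rfl, rfl⟩ | ⟨hR, rfl, rfl⟩
    · exact (filter_eq_antilex_iff h.nodup hm).1 (Finset.mem_filter.1 hR).2 x hx y hy hxy
    · rcases h.restrict X hX with e | e
      · exact (filter_eq_lex_iff h.nodup hm).1 e x hx y hy hxy
      · exact absurd (Finset.mem_filter.2 ⟨hX, e⟩) hR

/-- Reversal sets are consistent. -/
theorem IsLinExt.isConsistent (hk : 0 < k) {R : Finset (Finset (Fin n))}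
    {ρ : List (Finset (Fin n))} (hR : R ⊆ Inv w (k + 1)) (h : IsLinExt w k R ρ) :
    IsConsistent w (k + 1) R := by
  refine LocallyTransitive.isConsistent hk hR ?_
  intro C a b c hab hbc ha hb hc hCa hCb hCc
  have hac := hab.trans hbc
  have key : ∀ x y, x < y → x ∉ C → y ∉ C → insert x C ∈ Inv w k → insert y C ∈ Inv w k →
      (¬ Flipped w R (insert x (insert y C)) → ρ.idxOf (insert x C) < ρ.idxOf (insert y C)) ∧
      (Flipped w R (insert x (insert y C)) → ρ.idxOf (insert y C) < ρ.idxOf (insert x C)) :=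
    fun x y hxy hx hy hCx hCy =>
      ⟨fun hT => h.idxOf_lt ⟨C, x, y, hxy, hx, hy, hCx, hCy, Or.inl ⟨hT, rfl, rfl⟩⟩,
        fun hT => h.idxOf_lt ⟨C, x, y, hxy, hx, hy, hCx, hCy, Or.inr ⟨hT, rfl, rfl⟩⟩⟩
  -- Positions in `ρ` linearly order the three sets containing `C`, so their pairwise orientations
  -- cannot form a cycle.
  have k1 := key a b hab ha hb hCa hCb
  have k2 := key b c hbc hb hc hCb hCc
  have k3 := key a c hac ha hc hCa hCc
  constructor
  · intro h1 h2
    by_contra h3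
    exact absurd ((k2.2 h2).trans (k1.2 h1)) (k3.1 h3).asymm
  · intro h1 h2 h3
    exact absurd ((k1.1 h1).trans (k2.1 h2)) (k3.2 h3).asymm

end HigherBruhat

/-! ### Commutations and packet flips -/

namespace HigherBruhat
variable {n : ℕ}

section Swap
variable {α : Type*} {P : α → α → Prop} {M : α → Prop}

/-- Exchange of two adjacent entries satisfying `M` that are incomparable for `P`. -/
def SwapStep (P : α → α → Prop) (M : α → Prop) (s t : List α) : Prop :=
  ∃ a b x y, x ≠ y ∧ M x ∧ M y ∧ ¬ P x y ∧ ¬ P y x ∧ s = a ++ [x, y] ++ b ∧ t = a ++ [y, x] ++ b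

theorem SwapStep.cons {s t : List α} (c : α) (h : SwapStep P M s t) :
    SwapStep P M (c :: s) (c :: t) := by
  obtain ⟨a, b, x, y, h1, h2, h3, h4, h5, rfl, rfl⟩ := h
  exact ⟨c :: a, b, x, y, h1, h2, h3, h4, h5, rfl, rfl⟩

theorem swap_to_front {x : α} (hx : M x) (r : List α) :
    ∀ l : List α, (∀ a ∈ l, a ≠ x ∧ ¬ P a x ∧ ¬ P x a ∧ M a) →
      Relation.ReflTransGen (SwapStep P M) (l ++ x :: r) (x :: (l ++ r)) := by
  intro l
  induction l with
  | nil => exact fun _ => .refl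
  | cons a l ih =>
    intro h
    have h1 := (ih fun b hb => h b (by simp [hb])).lift (a :: ·) fun _ _ => SwapStep.cons a
    have ha := h a (by simp)
    exact h1.tail ⟨[], l ++ r, a, x, ha.1, ha.2.2.2, hx, ha.2.1, ha.2.2.1, rfl, rfl⟩

/-- Two linear extensions of the same relation are connected by swaps. -/
theorem reflTransGen_swapStep : ∀ l' l : List α, l.Perm l' → l.Nodup →
    (l.Pairwise fun a b => ¬ P b a) → (l'.Pairwise fun a b => ¬ P b a) → (∀ a ∈ l, M a) →
      Relation.ReflTransGen (SwapStep P M) l l' := by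
  intro l'
  induction l' with
  | nil => intro l hp _ _ _ _; rw [hp.eq_nil]
  | cons x l' ih =>
    intro l hp hnd h1 h2 hM
    obtain ⟨s, r, rfl⟩ := List.append_of_mem (hp.symm.subset (List.mem_cons_self (a := x) (l := l')))
    have hp' : (x :: (s ++ r)).Perm (x :: l') := List.perm_middle.symm.trans hp
    have hp'' := (List.perm_cons x).1 hp'
    have hnd' : (x :: (s ++ r)).Nodup := List.perm_middle.nodup_iff.1 hnd
    rw [List.pairwise_cons] at h2
    have hfront : ∀ a ∈ s, a ≠ x ∧ ¬ P a x ∧ ¬ P x a ∧ M a := by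
      intro a ha
      refine ⟨?_, h2.1 a (hp''.subset (by simp [ha])), ?_, hM a (by simp [ha])⟩
      · rintro rfl
        exact (List.nodup_cons.1 hnd').1 (by simp [ha])
      · exact (List.pairwise_append.1 h1).2.2 a ha x (by simp)
    refine (swap_to_front (hM x (by simp)) r s hfront).trans ?_
    refine (ih (s ++ r) hp'' (List.nodup_cons.1 hnd').2 ?_ h2.2
      fun a ha => hM a ?_).lift (x :: ·) fun _ _ => SwapStep.cons x
    · exact h1.sublist ((List.append_sublist_append_left s).2 (List.sublist_cons_self x r))
    · rcases List.mem_append.1 ha with h | h <;> simp [h]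

end Swap

variable {w : Equiv.Perm (Fin n)} {k : ℕ} {R : Finset (Finset (Fin n))}
  {ρ σ : List (Finset (Fin n))}

/-- The swaps are taken for the transitive closure of `Prec`. Incomparability there excludes
comparability in the permanent poset, and it excludes a common packet since `Prec` is total on the
inversions in a packet; so each swap is a commutation. -/
theorem IsLinExt.commEquiv (hR : R ⊆ Inv w (k + 1)) (hρ : IsLinExt w k R ρ)
    (hσ : IsLinExt w k R σ) : CommEquiv w k ρ σ := by
  have key : ∀ {τ}, IsLinExt w k R τ →
      τ.Pairwise fun A B => ¬ Relation.TransGen (Prec w k (Flipped w R)) B A := by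
    intro τ hτ
    refine (pairwise_idxOf hτ.nodup).imp fun {A B} hAB hBA => ?_
    have : τ.idxOf B < τ.idxOf A := by
      clear hAB
      induction hBA with
      | single h => exact hτ.idxOf_lt h
      | tail _ h ih => exact ih.trans (hτ.idxOf_lt h)
    exact this.asymm hAB
  have hp : ρ.Perm σ := (List.perm_ext_iff_of_nodup hρ.nodup hσ.nodup).2 fun A => by
    rw [hρ.mem_iff, hσ.mem_iff]
  refine Relation.ReflTransGen.mono ?_ _ _ (reflTransGen_swapStep (M := fun A => A ∈ Inv w k) σ ρ hp
    hρ.nodup (key hρ) (key hσ) fun A hA => (hρ.mem_iff A).1 hA)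
  rintro s t ⟨a, b, X, Y, hne, hX, hY, hXY, hYX, rfl, rfl⟩
  have hperm : ∀ A B, A ≠ B → PermLE w k A B →
      Relation.TransGen (Prec w k (Flipped w R)) A B := by
    intro A B hAB h
    rcases Relation.reflTransGen_iff_eq_or_transGen.1 h with h | h
    · exact absurd h.symm hAB
    · exact Relation.TransGen.mono (fun _ _ => quasiRel_prec hR) _ _ h
  refine ⟨a, b, X, Y, ⟨fun h => hXY (hperm _ _ hne h), fun h => hYX (hperm _ _ hne.symm h), ?_⟩,
    rfl, rfl⟩
  rintro ⟨Z, -, hXZ, hYZ⟩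
  rcases prec_or_prec (Flipped w R) hX hY hXZ hYZ hne with h | h
  · exact hXY (.single h)
  · exact hYX (.single h)

theorem IsLinExt.commStep (hρ : IsLinExt w k R ρ) (h : CommStep w k ρ σ) :
    IsLinExt w k R σ := by
  obtain ⟨a, b, X, Y, ⟨-, -, hc⟩, rfl, rfl⟩ := h
  have hp : (a ++ [X, Y] ++ b).Perm (a ++ [Y, X] ++ b) :=
    ((List.Perm.swap Y X []).append_left a).append_right b
  refine ⟨hp.nodup_iff.1 hρ.nodup, fun Z => by rw [← hp.mem_iff, hρ.mem_iff], ?_⟩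
  -- Commuting elements share no packet, whereas related ones do.
  have hXY : ¬ Prec w k (Flipped w R) X Y := fun h => hc h.exists_packet
  have := hρ.pairwise
  simp only [List.append_assoc, List.pairwise_append, List.pairwise_cons, List.mem_cons,
    List.cons_append, List.nil_append] at this ⊢
  grind

theorem IsLinExt.commEquiv_right (hρ : IsLinExt w k R ρ) (h : CommEquiv w k ρ σ) :
    IsLinExt w k R σ := by
  induction (show Relation.ReflTransGen (CommStep w k) ρ σ from h) with
  | refl => exact hρ
  | tail h₁ h₂ ih => exact (ih h₁).commStep h₂

/-- The orientation of a packet is determined by the relation on its members. -/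
theorem prec_erase {T : Finset (Fin n) → Prop} {X : Finset (Fin n)} {u v : Fin n} (hu : u ∈ X)
    (hv : v ∈ X) (huv : u < v) :
    (Prec w k T (X.erase u) (X.erase v) → T X) ∧
    (Prec w k T (X.erase v) (X.erase u) → ¬ T X) := by
  have key : ∀ {C : Finset (Fin n)} {x y : Fin n}, x ≠ y → x ∉ C → y ∉ C →
      X.erase u = insert y C → X.erase v = insert x C →
      x = u ∧ y = v ∧ insert x (insert y C) = X := by
    intro C x y hxy hx hy h1 h2
    have hux : u = x := by
      have : u ∈ insert x C := by rw [← h2]; simp [hu, huv.ne]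
      rcases Finset.mem_insert.1 this with h | h
      · exact h
      · exact absurd (by rw [h1]; simp [h] : u ∈ X.erase u) (by simp)
    have hvy : v = y := by
      have : v ∈ insert y C := by rw [← h1]; simp [hv, huv.ne']
      rcases Finset.mem_insert.1 this with h | h
      · exact h
      · exact absurd (by rw [h2]; simp [h] : v ∈ X.erase v) (by simp)
    exact ⟨hux.symm, hvy.symm, by rw [← h1, ← hux, Finset.insert_erase hu]⟩
  constructor
  · rintro ⟨C, x, y, hxy, hx, hy, -, -, ⟨hT, h1, h2⟩ | ⟨hT, h1, h2⟩⟩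
    · obtain ⟨rfl, rfl, -⟩ := key hxy.ne' hy hx h1 h2
      exact absurd hxy huv.asymm
    · rwa [(key hxy.ne hx hy h1 h2).2.2] at hT
  · rintro ⟨C, x, y, hxy, hx, hy, -, -, ⟨hT, h1, h2⟩ | ⟨hT, h1, h2⟩⟩
    · rwa [(key hxy.ne hx hy h2 h1).2.2] at hT
    · obtain ⟨rfl, rfl, -⟩ := key hxy.ne' hy hx h2 h1
      exact absurd hxy huv.asymm

/-- Adding `X` to `R` changes the relation on the packet of `X` only. -/
theorem prec_insert_iff {X A B : Finset (Fin n)} (h : ¬ (A ∈ packet X ∧ B ∈ packet X)) :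
    Prec w k (Flipped w (insert X R)) A B ↔ Prec w k (Flipped w R) A B := by
  have key : ∀ {C : Finset (Fin n)} {x y : Fin n}, x < y → x ∉ C → y ∉ C →
      (A = insert x C ∧ B = insert y C ∨ A = insert y C ∧ B = insert x C) →
      (Flipped w (insert X R) (insert x (insert y C)) ↔ Flipped w R (insert x (insert y C))) := by
    intro C x y hxy hx hy hAB
    have hne : insert x (insert y C) ≠ X := by
      rintro rfl
      have h1 : insert x C ∈ packet (insert x (insert y C)) :=
        mem_packet.2 ⟨y, by simp, (erase_insert_insert_right hxy.ne hy).symm⟩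
      have h2 : insert y C ∈ packet (insert x (insert y C)) :=
        mem_packet.2 ⟨x, by simp, (erase_insert_insert_left hxy.ne hx).symm⟩
      rcases hAB with ⟨rfl, rfl⟩ | ⟨rfl, rfl⟩
      · exact h ⟨h1, h2⟩
      · exact h ⟨h2, h1⟩
    simp only [Flipped, Finset.mem_insert, hne, false_or]
  constructor
  all_goals
    rintro ⟨C, x, y, hxy, hx, hy, hCx, hCy, ⟨hT, hA, hB⟩ | ⟨hT, hA, hB⟩⟩
    · have := key hxy hx hy (Or.inl ⟨hA, hB⟩)
      exact ⟨C, x, y, hxy, hx, hy, hCx, hCy, Or.inl ⟨by simpa only [this] using hT, hA, hB⟩⟩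
    · have := key hxy hx hy (Or.inr ⟨hA, hB⟩)
      exact ⟨C, x, y, hxy, hx, hy, hCx, hCy, Or.inr ⟨by simpa only [this] using hT, hA, hB⟩⟩

/-- Only pairs inside the packet of `X` change relative position, and only their relations change
when `X` joins `R`. -/
theorem IsLinExt.flip (hk : 0 < k) {a b : List (Finset (Fin n))} {X : Finset (Fin n)}
    (hX : X ∈ Inv w (k + 1)) (h : IsLinExt w k R (a ++ lex X ++ b)) :
    X ∉ R ∧ IsLinExt w k (insert X R) (a ++ antilex X ++ b) := by
  have hp : (a ++ lex X ++ b).Perm (a ++ antilex X ++ b) :=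
    ((List.reverse_perm _).append_left a).append_right b
  have hsub : (lex X).Sublist (a ++ lex X ++ b) :=
    (List.sublist_append_right a _).trans (List.sublist_append_left _ b)
  have hnd := h.nodup
  have ha : ∀ A ∈ a, A ∉ packet X := fun A hA hAX => by
    rw [List.append_assoc, List.nodup_append] at hnd
    exact hnd.2.2 A hA A (by simp [mem_lex.2 hAX]) rfl
  have hb : ∀ A ∈ b, A ∉ packet X := fun A hA hAX => by
    rw [List.nodup_append] at hnd
    exact hnd.2.2 A (by simp [mem_lex.2 hAX]) A hA rfl
  refine ⟨fun hXR => ?_, hp.nodup_iff.1 hnd, fun Z => by rw [← hp.mem_iff, h.mem_iff], ?_⟩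
  · obtain ⟨x, hx, y, hy, hne⟩ := Finset.one_lt_card.1
      (show 1 < X.card by rw [(mem_Inv.1 hX).1]; omega)
    wlog hxy : x < y generalizing x y
    · exact this y hy x hx hne.symm (lt_of_le_of_ne (not_lt.1 hxy) hne.symm)
    have h1 := (pairwise_idxOf hnd).sublist hsub
    rw [lex, List.pairwise_reverse] at h1
    exact (antilex_rel h1 hx hy hxy).asymm ((h.idxOf_erase hX hx hy hxy).1 hXR)
  · have h1 := h.pairwise
    rw [List.pairwise_append, List.pairwise_append] at h1 ⊢
    obtain ⟨⟨p1, -, p3⟩, p4, p5⟩ := h1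
    refine ⟨⟨?_, ?_, ?_⟩, ?_, ?_⟩
    · refine p1.imp_of_mem fun {A B} hA _ => ?_
      rw [prec_insert_iff fun h => ha A hA h.2]; exact id
    · refine (pairwise_antilex X).imp ?_
      rintro A B ⟨x, hx, y, hy, hxy, rfl, rfl⟩ h'
      exact (prec_erase hx hy hxy).2 h' (Or.inl (by simp))
    · intro A hA B hB
      rw [prec_insert_iff fun h => ha A hA h.2]
      exact p3 A hA B (mem_lex.2 (mem_antilex.1 hB))
    · refine p4.imp_of_mem fun {A B} hA _ => ?_
      rw [prec_insert_iff fun h => hb A hA h.2]; exact id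
    · intro A hA B hB
      rw [prec_insert_iff fun h => hb B hB h.1]
      refine p5 A ?_ B hB
      rcases List.mem_append.1 hA with h | h
      · simp [h]
      · exact List.mem_append_right _ (mem_lex.2 (mem_antilex.1 h))

theorem IsConsistent.exists_isLinExt (h : IsConsistent w (k + 1) R) :
    ∃ ρ, IsLinExt w k R ρ := by
  obtain ⟨f, hf⟩ := h.exists_height
  have hp := List.perm_insertionSort (fun A B => f A ≤ f B) (Inv w k).toList
  refine ⟨(Inv w k).toList.insertionSort fun A B => f A ≤ f B, hp.nodup_iff.2
    (Finset.nodup_toList _), fun X => by rw [hp.mem_iff, Finset.mem_toList], ?_⟩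
  have : Std.Total fun A B : Finset (Fin n) => f A ≤ f B := ⟨fun A B => le_total _ _⟩
  have : IsTrans _ fun A B : Finset (Fin n) => f A ≤ f B := ⟨fun A B C => le_trans⟩
  exact (List.pairwise_insertionSort (fun A B => f A ≤ f B) _).imp
    fun hle hp => (not_lt.2 hle) (hf _ _ hp)

/-- If `X` can be added to `R`, then some linear extension for `R` contains the packet of `X` as
an interval. -/
theorem IsConsistent.exists_isLinExt_lex {X : Finset (Fin n)} (h : IsConsistent w (k + 1) R)
    (h' : IsConsistent w (k + 1) (insert X R)) (hXR : X ∉ R) :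
    ∃ a b, IsLinExt w k R (a ++ lex X ++ b) := by
  have hX : X ∈ Inv w (k + 1) := h'.subset (by simp)
  obtain ⟨f, hf⟩ := h.exists_height
  obtain ⟨f', hf'⟩ := h'.exists_height
  obtain ⟨ρ, hρ⟩ := h.exists_isLinExt
  -- The relations common to `R` and `insert X R`. An `E`-path between two faces of `X` would
  -- respect both lex and antilex order on the packet, which is impossible; hence the packet is
  -- `E`-convex.
  let E : Finset (Fin n) → Finset (Fin n) → Prop := fun A B =>
    Prec w k (Flipped w R) A B ∧ ¬ (A ∈ packet X ∧ B ∈ packet X)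
  have hE : ∀ {A B}, Relation.TransGen E A B → f A < f B ∧ f' A < f' B := by
    intro A B hAB
    induction hAB with
    | single h => exact ⟨hf _ _ h.1, hf' _ _ ((prec_insert_iff h.2).2 h.1)⟩
    | tail _ h ih =>
      exact ⟨ih.1.trans (hf _ _ h.1), ih.2.trans (hf' _ _ ((prec_insert_iff h.2).2 h.1))⟩
  have hconv : ∀ {A p}, A ∈ packet X → p ∈ packet X → ¬ Relation.TransGen E A p := by
    intro A p hA hp hAp
    obtain ⟨u, hu, rfl⟩ := mem_packet.1 hA
    obtain ⟨v, hv, rfl⟩ := mem_packet.1 hp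
    have h1 := hE hAp
    rcases lt_trichotomy u v with e | rfl | e
    · exact ((height_faces hf hX hu hv e).2 hXR).asymm h1.1
    · exact lt_irrefl _ h1.1
    · exact ((height_faces hf' hX hv hu e).1 (by simp)).asymm h1.2
  classical
  -- The elements forced before the packet. The new order lists `D`, then the packet, then the rest,
  -- each in the order of `ρ`.
  let D : Finset (Fin n) → Prop := fun A =>
    A ∉ packet X ∧ ∃ p ∈ packet X, Relation.ReflTransGen E A p
  have hfl : ρ.filter (fun A => A ∈ packet X) = lex X := (hρ.filter_eq hX).2 hXR
  refine ⟨ρ.filter fun A => D A, ρ.filter fun A => ¬ D A ∧ A ∉ packet X, ?_⟩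
  rw [← hfl]
  refine ⟨?_, ?_, ?_⟩
  · rw [List.nodup_append, List.nodup_append]
    refine ⟨⟨hρ.nodup.filter _, hρ.nodup.filter _, ?_⟩, hρ.nodup.filter _, ?_⟩
    · rintro A hA _ hB rfl
      simp only [List.mem_filter, decide_eq_true_iff] at hA hB
      exact hA.2.1 hB.2
    · rintro A hA _ hB rfl
      simp only [List.mem_filter, List.mem_append, decide_eq_true_iff] at hA hB
      rcases hA with hA | hA
      · exact hB.2.1 hA.2
      · exact hB.2.2 hA.2
  · intro A
    simp only [List.mem_filter, List.mem_append, decide_eq_true_iff]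
    rw [← hρ.mem_iff]
    by_cases h1 : D A <;> by_cases h2 : A ∈ packet X <;> simp [h1, h2]
  · rw [List.pairwise_append, List.pairwise_append]
    refine ⟨⟨hρ.pairwise.filter _, hρ.pairwise.filter _, ?_⟩, hρ.pairwise.filter _, ?_⟩
    · intro A hA B hB hBA
      simp only [List.mem_filter, decide_eq_true_iff] at hA hB
      obtain ⟨-, hA, p, hp, hAp⟩ := hA
      exact hconv hB.2 hp (.head' ⟨hBA, fun h => hA h.2⟩ hAp)
    · intro A hA B hB hBA
      simp only [List.mem_filter, List.mem_append, decide_eq_true_iff] at hA hB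
      refine hB.2.1 ⟨hB.2.2, ?_⟩
      rcases hA with ⟨-, hA, p, hp, hAp⟩ | ⟨-, hA⟩
      · exact ⟨p, hp, .head ⟨hBA, fun h => hA h.2⟩ hAp⟩
      · exact ⟨A, hA, .single ⟨hBA, fun h => hB.2.2 h.1⟩⟩

end HigherBruhat

/-! ### The poset of consistent sets and the isomorphism -/

namespace HigherBruhat
variable {n : ℕ} {w : Equiv.Perm (Fin n)} {k : ℕ}

theorem isConsistent_empty : IsConsistent w k ∅ :=
  .of_quasiRel (Finset.empty_subset _) (by simp) (by simp)

theorem isConsistent_Inv : IsConsistent w k (Inv w k) :=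
  .of_quasiRel (Finset.Subset.refl _) (fun _ _ h _ => h.mem_Inv.1)
    fun _ hX _ ha _ hb _ _ _ _ =>
      ⟨fun _ _ => erase_mem_Inv hX hb, fun h => absurd (erase_mem_Inv hX ha) h⟩

/-- A consistent set as an element of the poset of consistent sets. -/
def IsConsistent.toConsistentSet {R : Finset (Finset (Fin n))} (h : IsConsistent w k R) :
    ConsistentSet w k := ⟨R, h⟩

@[simp]
theorem IsConsistent.val_toConsistentSet {R : Finset (Finset (Fin n))}
    (h : IsConsistent w k R) : h.toConsistentSet.1 = R := rfl

namespace ConsistentSet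

/-- The empty consistent set. -/
def empty : ConsistentSet w k := isConsistent_empty.toConsistentSet

/-- The consistent set of all inversions. -/
def full : ConsistentSet w k := isConsistent_Inv.toConsistentSet

theorem ext {R S : ConsistentSet w k} (h : R.1 = S.1) : R = S := Subtype.ext h

theorem card_lt_card {R S : ConsistentSet w k} (h : R < S) : R.1.card < S.1.card := by
  refine Finset.card_lt_card ((subset_of_le h.le).ssubset_of_ne fun e => h.ne (ext e))

theorem eq_of_le_of_card {R S : ConsistentSet w k} (h : R ≤ S) (hc : R.1.card = S.1.card) :
    R = S := by
  by_contra hne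
  exact (card_lt_card (lt_of_le_of_ne h hne)).ne hc

end ConsistentSet

theorem SingleStep.le {R S : ConsistentSet w k} (h : SingleStep w k R S) : R ≤ S :=
  Relation.ReflTransGen.single h

theorem SingleStep.card_eq {R S : ConsistentSet w k} (h : SingleStep w k R S) :
    S.1.card = R.1.card + 1 := by
  obtain ⟨X, hX, e⟩ := h
  rw [e, Finset.card_insert_of_notMem hX]

theorem SingleStep.covBy {R S : ConsistentSet w k} (h : SingleStep w k R S) : R ⋖ S := by
  refine ⟨lt_of_le_of_ne h.le fun e => ?_, fun T h1 h2 => ?_⟩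
  · have := h.card_eq
    rw [e] at this
    omega
  · have := h.card_eq
    have := ConsistentSet.card_lt_card h1
    have := ConsistentSet.card_lt_card h2
    omega

theorem exists_singleStep_of_lt {R S : ConsistentSet w k} (h : R < S) :
    ∃ T, SingleStep w k R T ∧ T ≤ S := by
  rcases Relation.ReflTransGen.cases_head (show Relation.ReflTransGen (SingleStep w k) R S from h.le)
    with e | ⟨T, h1, h2⟩
  · exact absurd e h.ne
  · exact ⟨T, h1, h2⟩

theorem singleStep_of_covBy {R S : ConsistentSet w k} (h : R ⋖ S) : SingleStep w k R S := by
  obtain ⟨T, h1, h2⟩ := exists_singleStep_of_lt h.lt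
  rcases h2.eq_or_lt with rfl | h2
  · exact h1
  · exact absurd h2 (h.2 h1.covBy.lt)

theorem empty_le (R : ConsistentSet w (k + 1)) :
    ConsistentSet.empty ≤ R := by
  obtain ⟨m, hm⟩ : ∃ m, R.1.card = m := ⟨_, rfl⟩
  induction m generalizing R with
  | zero => exact le_of_eq (ConsistentSet.ext (Finset.card_eq_zero.1 hm).symm)
  | succ m ih =>
    obtain ⟨X, hX, hc⟩ := R.2.exists_erase (Finset.card_pos.1 (by omega))
    refine (ih hc.toConsistentSet ?_).trans
      (SingleStep.le ⟨X, by simp, (Finset.insert_erase hX).symm⟩)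
    rw [hc.val_toConsistentSet, Finset.card_erase_of_mem hX, hm]; rfl

theorem le_Inv (R : ConsistentSet w (k + 1)) :
    R ≤ ConsistentSet.full := by
  obtain ⟨m, hm⟩ : ∃ m, (Inv w (k + 1)).card - R.1.card = m := ⟨_, rfl⟩
  induction m generalizing R with
  | zero =>
    exact le_of_eq (ConsistentSet.ext (Finset.eq_of_subset_of_card_le R.2.subset
      (Nat.sub_eq_zero_iff_le.1 hm)))
  | succ m ih =>
    obtain ⟨X, hX, hc⟩ := R.2.exists_insert (by intro e; rw [e] at hm; omega)
    refine le_trans (SingleStep.le ⟨X, hX, rfl⟩) (ih hc.toConsistentSet ?_)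
    rw [hc.val_toConsistentSet, Finset.card_insert_of_notMem hX]; omega

theorem eq_empty_of_isMin {R : ConsistentSet w (k + 1)} (h : IsMin R) :
    R = ConsistentSet.empty :=
  le_antisymm (h (empty_le R)) (empty_le R)

theorem eq_Inv_of_isMax {R : ConsistentSet w (k + 1)} (h : IsMax R) :
    R = ConsistentSet.full :=
  le_antisymm (le_Inv R) (h (le_Inv R))

/-- Consistent sets are graded by cardinality. -/
abbrev gradeConsistent (w : Equiv.Perm (Fin n)) (k : ℕ) :
    GradeMinOrder ℕ (ConsistentSet w (k + 1)) where
  grade R := R.1.card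
  grade_strictMono _ _ := ConsistentSet.card_lt_card
  covBy_grade R S h := by
    rw [(singleStep_of_covBy h).card_eq]
    exact Order.covBy_add_one _
  isMin_grade R h := by
    rw [eq_empty_of_isMin h]
    exact isMin_bot

theorem Reach.exists_le (hk : 0 < k) {ρ σ : List (Finset (Fin n))}
    {R : ConsistentSet w (k + 1)} (hρ : IsLinExt w k R.1 ρ) (h : Reach w k ρ σ) :
    ∃ S : ConsistentSet w (k + 1), IsLinExt w k S.1 σ ∧ R ≤ S := by
  induction (show Relation.ReflTransGen _ ρ σ from h) with
  | refl => exact ⟨R, hρ, le_rfl⟩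
  | tail h₁ h₂ ih =>
    obtain ⟨S, hS, hRS⟩ := ih h₁
    rcases h₂ with h₂ | ⟨a, b, X, hX, rfl, rfl⟩
    · exact ⟨S, hS.commStep h₂, hRS⟩
    · obtain ⟨hXS, hl⟩ := hS.flip hk hX
      have hsub := Finset.insert_subset hX S.2.subset
      exact ⟨(hl.isConsistent hk hsub).toConsistentSet, hl,
        hRS.trans (SingleStep.le ⟨X, hXS, rfl⟩)⟩

/-- At each single step adding `X`, commutations lead to a linear extension with the packet of `X`
consecutive in lex order; flipping it performs the step. -/
theorem reach_of_le (hk : 0 < k) {R S : ConsistentSet w (k + 1)} (h : R ≤ S)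
    {ρ σ : List (Finset (Fin n))} (hρ : IsLinExt w k R.1 ρ) (hσ : IsLinExt w k S.1 σ) :
    Reach w k ρ σ := by
  induction (show Relation.ReflTransGen (SingleStep w (k + 1)) R S from h) generalizing σ with
  | refl => exact (hρ.commEquiv R.2.subset hσ).reach
  | @tail T S h₁ h₂ ih =>
    obtain ⟨X, hX, e⟩ := h₂
    have hc : IsConsistent w (k + 1) (insert X T.1) := e ▸ S.2
    obtain ⟨a, b, hab⟩ := T.2.exists_isLinExt_lex hc hX
    have hXI : X ∈ Inv w (k + 1) := hc.subset (by simp)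
    have hfl := (hab.flip hk hXI).2
    rw [← e] at hfl
    exact ((ih h₁ hab).tail (Or.inr ⟨a, b, X, hXI, rfl, rfl⟩)).trans
      (hfl.commEquiv S.2.subset hσ).reach

/-- The reversal set of an admissible order, as a consistent set. -/
def revSet (hk : 0 < k) (ρ : AdmissibleOrder w k) : ConsistentSet w (k + 1) :=
  (ρ.2.isLinExt.isConsistent hk (rev_subset _)).toConsistentSet

theorem reach_iff (hk : 0 < k) (ρ σ : AdmissibleOrder w k) :
    Reach w k ρ.1 σ.1 ↔ revSet hk ρ ≤ revSet hk σ := by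
  constructor
  · intro h
    obtain ⟨S, hS, hle⟩ := h.exists_le (R := revSet hk ρ) hk ρ.2.isLinExt
    have e : S = revSet hk σ := ConsistentSet.ext (hS.rev_eq hk S.2.subset).symm
    rwa [← e]
  · exact fun h => reach_of_le hk h ρ.2.isLinExt σ.2.isLinExt

theorem commEquiv_iff (hk : 0 < k) (ρ σ : AdmissibleOrder w k) :
    CommEquiv w k ρ.1 σ.1 ↔ revSet hk ρ = revSet hk σ := by
  constructor
  · intro h
    exact ConsistentSet.ext ((ρ.2.isLinExt.commEquiv_right h).rev_eq hk (rev_subset _)).symm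
  · intro h
    have hσ := σ.2.isLinExt
    rw [show Rev w k σ.1 = Rev w k ρ.1 from congrArg Subtype.val h.symm] at hσ
    exact ρ.2.isLinExt.commEquiv (rev_subset _) hσ

theorem revSet_surjective (hk : 0 < k) (R : ConsistentSet w (k + 1)) :
    ∃ ρ, revSet hk ρ = R := by
  obtain ⟨ρ, hρ⟩ := R.2.exists_isLinExt
  exact ⟨⟨ρ, hρ.isAdmissible R.2.subset⟩, ConsistentSet.ext (hρ.rev_eq hk R.2.subset)⟩

/-- The isomorphism sending a commutation class to its reversal set. -/
noncomputable def revIso (w : Equiv.Perm (Fin n)) (hk : 0 < k) :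
    BruhatOrder w k ≃o ConsistentSet w (k + 1) where
  toEquiv := Equiv.ofBijective
    (Quotient.lift (revSet hk) fun ρ σ h => (commEquiv_iff hk ρ σ).1 h)
    ⟨fun a b => Quotient.inductionOn₂ a b fun ρ σ h =>
        Quotient.sound ((commEquiv_iff hk ρ σ).2 h),
      fun R => let ⟨ρ, hρ⟩ := revSet_surjective hk R; ⟨cls w k ρ, hρ⟩⟩
  map_rel_iff' {a b} := Quotient.inductionOn₂ a b fun ρ σ => (reach_iff hk ρ σ).symm

theorem revIso_cls (hk : 0 < k) (ρ : AdmissibleOrder w k) :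
    (revIso w hk (cls w k ρ)).1 = Rev w k ρ.1 := rfl

/-- Commutation classes are graded by the size of the reversal set. -/
noncomputable abbrev gradeBruhat (w : Equiv.Perm (Fin n)) (hk : 0 < k) :
    GradeMinOrder ℕ (BruhatOrder w k) :=
  letI := gradeConsistent w k
  GradeMinOrder.liftRight (revIso w hk) (revIso w hk).strictMono
    (fun _ _ => (apply_covBy_apply_iff (revIso w hk)).2)
    fun _ h => (OrderIso.isMin_apply (revIso w hk)).2 h

end HigherBruhat

/-! ### Maximal chains and admissible orders -/

namespace HigherBruhat
variable {n : ℕ} {w : Equiv.Perm (Fin n)} {k : ℕ}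

theorem mem_take_iff_idxOf_lt {α : Type*} [DecidableEq α] {l : List α} {a : α} (ha : a ∈ l)
    (hl : l.Nodup) (i : ℕ) : a ∈ l.take i ↔ l.idxOf a < i := by
  rw [List.mem_take_iff_getElem]
  constructor
  · rintro ⟨j, hj, rfl⟩
    rw [hl.idxOf_getElem]
    omega
  · intro h
    exact ⟨l.idxOf a, lt_min h (List.idxOf_lt_length_of_mem ha), List.getElem_idxOf _⟩

/-- Initial segments of an admissible order are consistent. -/
theorem IsAdmissible.isConsistent_take {ρ : List (Finset (Fin n))} (h : IsAdmissible w k ρ)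
    (i : ℕ) : IsConsistent w k (ρ.take i).toFinset := by
  have hmem : ∀ A ∈ Inv w k, (A ∈ (ρ.take i).toFinset ↔ ρ.idxOf A < i) := fun A hA => by
    rw [List.mem_toFinset, mem_take_iff_idxOf_lt ((h.mem_iff A).2 hA) h.nodup]
  refine .of_quasiRel ?_ ?_ ?_
  · intro A hA
    exact (h.mem_iff A).1 (List.mem_of_mem_take (List.mem_toFinset.1 hA))
  · intro A B hAB
    rw [hmem A hAB.mem_Inv.1, hmem B hAB.mem_Inv.2]
    exact lt_of_le_of_lt (h.linearExtension A hAB.mem_Inv.1 B hAB.mem_Inv.2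
      (Relation.ReflTransGen.single hAB))
  · intro X hX a ha b hb c hc hab hbc
    have hm : ∀ x ∈ X, X.erase x ∈ ρ := fun x hx => (h.mem_iff _).2 (erase_mem_Inv hX hx)
    rw [hmem _ (erase_mem_Inv hX ha), hmem _ (erase_mem_Inv hX hb), hmem _ (erase_mem_Inv hX hc)]
    rcases h.restrict X hX with e | e
    · rw [filter_eq_lex_iff h.nodup hm] at e
      have h1 := e a ha b hb hab
      have h2 := e b hb c hc hbc
      constructor <;> intros <;> omega
    · rw [filter_eq_antilex_iff h.nodup hm] at e
      have h1 := e a ha b hb hab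
      have h2 := e b hb c hc hbc
      constructor <;> intros <;> omega

/-- An injective function on a finite linear order that preserves betweenness is strictly
monotone or strictly antitone. -/
theorem strictMonoOn_or_strictAntiOn_of_between {X : Finset (Fin n)} {j : Fin n → ℕ}
    (hinj : ∀ a ∈ X, ∀ b ∈ X, j a = j b → a = b)
    (hbt : ∀ a ∈ X, ∀ b ∈ X, ∀ c ∈ X, a < b → b < c →
      (j b < j a ∨ j b < j c) ∧ (j a < j b ∨ j c < j b)) :
    (∀ x ∈ X, ∀ y ∈ X, x < y → j y < j x) ∨ (∀ x ∈ X, ∀ y ∈ X, x < y → j x < j y) := by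
  rcases X.eq_empty_or_nonempty with rfl | hne
  · simp
  obtain ⟨p, hp, hmin⟩ := Finset.exists_min_image X id hne
  obtain ⟨q, hq, hmax⟩ := Finset.exists_max_image X id hne
  simp only [id] at hmin hmax
  -- The values at the least and greatest entries decide the direction; betweenness then places `x`
  -- and `y`, whether or not they are extreme.
  rcases le_or_gt (j q) (j p) with hpq | hpq
  · left
    intro x hx y hy hxy
    have hpq' : j q < j p := lt_of_le_of_ne hpq fun e => by
      have := hinj _ hq _ hp e
      subst this
      exact absurd (hmin x hx |>.trans_lt hxy) (not_lt.2 (hmax y hy))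
    rcases (hmin x hx).eq_or_lt with rfl | h1 <;> rcases (hmax y hy).eq_or_lt with rfl | h2
    · exact hpq'
    · have := hbt _ hp _ hy _ hq hxy h2; omega
    · have := hbt _ hp _ hx _ hq h1 hxy; omega
    · have h3 := hbt _ hp _ hx _ hq h1 (hxy.trans h2)
      have h4 := hbt _ hp _ hy _ hq (h1.trans hxy) h2
      have h5 := hbt _ hp _ hx _ hy h1 hxy
      omega
  · right
    intro x hx y hy hxy
    rcases (hmin x hx).eq_or_lt with rfl | h1 <;> rcases (hmax y hy).eq_or_lt with rfl | h2
    · exact hpq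
    · have := hbt _ hp _ hy _ hq hxy h2; omega
    · have := hbt _ hp _ hx _ hq h1 hxy; omega
    · have h3 := hbt _ hp _ hx _ hq h1 (hxy.trans h2)
      have h4 := hbt _ hp _ hy _ hq (h1.trans hxy) h2
      have h5 := hbt _ hp _ hx _ hy h1 hxy
      omega

/-- A total order all of whose initial segments are consistent is admissible. -/
theorem isAdmissible_of_take {ρ : List (Finset (Fin n))} (hnd : ρ.Nodup)
    (hmem : ∀ X, X ∈ ρ ↔ X ∈ Inv w k) (h : ∀ i, IsConsistent w k (ρ.take i).toFinset) :
    IsAdmissible w k ρ := by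
  have hm : ∀ A ∈ Inv w k, ∀ i, (A ∈ (ρ.take i).toFinset ↔ ρ.idxOf A < i) := fun A hA i => by
    rw [List.mem_toFinset, mem_take_iff_idxOf_lt ((hmem A).2 hA) hnd]
  refine ⟨hnd, hmem, ?_, ?_⟩
  · intro X hX Y hY hXY
    have := (h (ρ.idxOf Y + 1)).ideal Y ((hm Y hY _).2 (Nat.lt_succ_self _)) X hX hXY
    exact Nat.lt_succ_iff.1 ((hm X hX _).1 this)
  · intro X hX
    have hm' : ∀ x ∈ X, X.erase x ∈ ρ := fun x hx => (hmem _).2 (erase_mem_Inv hX hx)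
    rw [filter_eq_lex_iff hnd hm', filter_eq_antilex_iff hnd hm']
    have hinj : ∀ a ∈ X, ∀ b ∈ X, ρ.idxOf (X.erase a) = ρ.idxOf (X.erase b) → a = b := by
      intro a ha b hb e
      rw [List.idxOf_inj (hm' a ha)] at e
      by_contra hne
      exact erase_ne_erase ha hne e
    refine strictMonoOn_or_strictAntiOn_of_between (j := fun x => ρ.idxOf (X.erase x)) hinj ?_
    intro a ha b hb c hc hab hbc
    have key := fun i => isPrefixOf_or_isSuffixOf_iff.1 ((h i).msz X hX) a ha b hb c hc hab hbc
    simp only [hm _ (erase_mem_Inv hX ha), hm _ (erase_mem_Inv hX hb),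
      hm _ (erase_mem_Inv hX hc)] at key
    have n1 : ρ.idxOf (X.erase a) ≠ ρ.idxOf (X.erase b) := fun e => hab.ne (hinj a ha b hb e)
    have n2 : ρ.idxOf (X.erase b) ≠ ρ.idxOf (X.erase c) := fun e => hbc.ne (hinj b hb c hc e)
    -- The shortest segment containing both outer faces must contain the middle one; the longest
    -- segment that avoids both, used next, must avoid it. So the middle face comes between them.
    have k1 := (key (max (ρ.idxOf (X.erase a)) (ρ.idxOf (X.erase c)) + 1)).1 (by omega) (by omega)
    have k2 := (key (min (ρ.idxOf (X.erase a)) (ρ.idxOf (X.erase c)))).2 (by omega) (by omega)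
    omega

namespace AdmissibleOrder

theorem length_eq (ρ : AdmissibleOrder w k) : ρ.1.length = (Inv w k).card := by
  rw [← List.toFinset_card_of_nodup ρ.2.nodup]
  congr 1
  ext A
  rw [List.mem_toFinset, ρ.2.mem_iff]

/-- The consistent set formed by the first `i` elements of an admissible order. -/
def segment (ρ : AdmissibleOrder w k) (i : ℕ) : ConsistentSet w k :=
  (ρ.2.isConsistent_take i).toConsistentSet

theorem val_segment (ρ : AdmissibleOrder w k) (i : ℕ) :
    (ρ.segment i).1 = (ρ.1.take i).toFinset := rfl

theorem card_segment (ρ : AdmissibleOrder w k) (i : ℕ) :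
    (ρ.segment i).1.card = min i (Inv w k).card := by
  rw [val_segment, List.toFinset_card_of_nodup (ρ.2.nodup.sublist (List.take_sublist _ _)),
    List.length_take, ρ.length_eq]

theorem segment_add_one (ρ : AdmissibleOrder w k) {i : ℕ} (hi : i < ρ.1.length) :
    ρ.1[i] ∉ (ρ.segment i).1 ∧ (ρ.segment (i + 1)).1 = insert ρ.1[i] (ρ.segment i).1 := by
  constructor
  · rw [val_segment, List.mem_toFinset, mem_take_iff_idxOf_lt (List.getElem_mem hi) ρ.2.nodup,
      ρ.2.nodup.idxOf_getElem]
    exact lt_irrefl i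
  · rw [val_segment, val_segment, List.take_succ_eq_append_getElem hi]
    ext A
    simp only [List.mem_toFinset, List.mem_append, List.mem_singleton, Finset.mem_insert, or_comm]

theorem singleStep_segment (ρ : AdmissibleOrder w k) {i : ℕ} (hi : i < (Inv w k).card) :
    SingleStep w k (ρ.segment i) (ρ.segment (i + 1)) :=
  ⟨_, ρ.segment_add_one (by rwa [ρ.length_eq])⟩

theorem segment_eq_of_le (ρ : AdmissibleOrder w k) {i : ℕ} (hi : (Inv w k).card ≤ i) :
    ρ.segment i = ρ.segment (Inv w k).card := by
  apply ConsistentSet.ext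
  rw [val_segment, val_segment, List.take_of_length_le (by rwa [ρ.length_eq]),
    List.take_of_length_le (by rw [ρ.length_eq])]

theorem segment_mono (ρ : AdmissibleOrder w k) : Monotone ρ.segment := by
  refine monotone_nat_of_le_succ fun i => ?_
  rcases lt_or_ge i (Inv w k).card with hi | hi
  · exact (ρ.singleStep_segment hi).le
  · rw [ρ.segment_eq_of_le hi, ρ.segment_eq_of_le (hi.trans (Nat.le_succ i))]

/-- Comparable consistent sets of equal cardinality coincide, and the segments realise every
cardinality up to that of `Inv w k`. -/
theorem mem_range_segment (ρ : AdmissibleOrder w k) {T : ConsistentSet w k}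
    (h : ∀ i, T ≤ ρ.segment i ∨ ρ.segment i ≤ T) : T ∈ Set.range ρ.segment := by
  have hc : (ρ.segment T.1.card).1.card = T.1.card := by
    rw [card_segment, min_eq_left (Finset.card_le_card T.2.subset)]
  refine ⟨T.1.card, ?_⟩
  rcases h T.1.card with h | h
  · exact (ConsistentSet.eq_of_le_of_card h hc.symm).symm
  · exact ConsistentSet.eq_of_le_of_card h hc

/-- The maximal chain of initial segments of an admissible order. -/
def flag (ρ : AdmissibleOrder w k) : Flag (ConsistentSet w k) where
  carrier := Set.range ρ.segment
  Chain' := by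
    rintro _ ⟨i, rfl⟩ _ ⟨j, rfl⟩ _
    exact (le_total i j).imp (fun h => ρ.segment_mono h) fun h => ρ.segment_mono h
  max_chain' := by
    intro s hs hsub
    refine hsub.antisymm fun T hT => ρ.mem_range_segment fun i => ?_
    exact hs.total hT (hsub ⟨i, rfl⟩)

theorem flag_injective : Function.Injective (flag (w := w) (k := k)) := by
  intro ρ σ h
  have hseg : ∀ i, i ≤ (Inv w k).card → ρ.segment i = σ.segment i := by
    intro i hi
    have h1 : ρ.segment i ∈ (flag σ).carrier := h ▸ ⟨i, rfl⟩
    obtain ⟨j, hj⟩ := h1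
    have h2 := congrArg (fun R => R.1.card) hj
    simp only [card_segment, min_eq_left hi] at h2
    rw [← hj]
    rcases le_total j (Inv w k).card with hj' | hj'
    · rw [min_eq_left hj'] at h2
      rw [h2]
    · rw [min_eq_right hj'] at h2
      rw [σ.segment_eq_of_le hj', h2]
  apply Subtype.ext
  refine List.ext_getElem (by rw [ρ.length_eq, σ.length_eq]) fun i hi hi' => ?_
  have h1 := ρ.segment_add_one hi
  have h2 := σ.segment_add_one hi'
  rw [hseg i (by rw [← ρ.length_eq]; omega), hseg (i + 1) (by rw [← ρ.length_eq]; omega)] at h1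
  have h3 : ρ.1[i] ∈ insert σ.1[i] (σ.segment i).1 := by
    rw [← h2.2, h1.2]; exact Finset.mem_insert_self _ _
  exact (Finset.mem_insert.1 h3).resolve_right h1.1

end AdmissibleOrder

/-- A maximal chain of consistent sets goes up by single steps. -/
theorem exists_singleStep_of_mem_flag (F : Flag (ConsistentSet w (k + 1)))
    {R : ConsistentSet w (k + 1)} (hR : R ∈ F) (hne : R.1 ≠ Inv w (k + 1)) :
    ∃ S ∈ F, SingleStep w (k + 1) R S := by
  classical
  have htop : ConsistentSet.full (w := w) (k := k + 1) ∈ F :=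
    Flag.mem_iff_forall_le_or_ge.2 fun T _ => Or.inr (le_Inv T)
  -- Least cardinality singles out the successor `S` of `R` in the chain. The first single step `T`
  -- from `R` towards `S` is comparable with the whole chain, so it belongs to it by maximality.
  have hex : ∃ m, ∃ S ∈ F, R < S ∧ S.1.card = m :=
    ⟨_, _, htop, lt_of_le_of_ne (le_Inv R) fun e => hne (congrArg Subtype.val e), rfl⟩
  obtain ⟨S, hS, hRS, hc⟩ := Nat.find_spec hex
  have hmin : ∀ T ∈ F, R < T → S ≤ T := by
    intro T hT hRT
    rcases F.le_or_le hS hT with h | h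
    · exact h
    · rcases h.eq_or_lt with rfl | h
      · exact le_rfl
      · exact absurd ⟨T, hT, hRT, rfl⟩ (Nat.find_min hex (hc ▸ ConsistentSet.card_lt_card h))
  obtain ⟨T, hRT, hTS⟩ := exists_singleStep_of_lt hRS
  refine ⟨T, Flag.mem_iff_forall_le_or_ge.2 fun U hU => ?_, hRT⟩
  rcases F.le_or_le hR hU with h | h
  · rcases h.eq_or_lt with rfl | h
    · exact Or.inr hRT.le
    · exact Or.inl (hTS.trans (hmin U hU h))
  · exact Or.inr (h.trans hRT.le)

/-- The chain is climbed from the empty set, recording the element added at each single step. -/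
theorem exists_list_of_flag (F : Flag (ConsistentSet w (k + 1))) (i : ℕ)
    (hi : i ≤ (Inv w (k + 1)).card) :
    ∃ l : List (Finset (Fin n)), l.length = i ∧ l.Nodup ∧
      ∀ j, ∃ R ∈ F, R.1 = (l.take j).toFinset := by
  induction i with
  | zero =>
    refine ⟨[], rfl, List.nodup_nil, fun j => ⟨ConsistentSet.empty, ?_, by simp [ConsistentSet.empty]⟩⟩
    exact Flag.mem_iff_forall_le_or_ge.2 fun T _ => Or.inl (empty_le T)
  | succ i ih =>
    obtain ⟨l, hl, hnd, hF⟩ := ih (by omega)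
    obtain ⟨R, hR, e⟩ := hF i
    rw [List.take_of_length_le hl.le] at e
    have hc : R.1.card = i := by rw [e, List.toFinset_card_of_nodup hnd, hl]
    obtain ⟨S, hS, X, hX, eS⟩ := exists_singleStep_of_mem_flag F hR
      (fun h => by rw [h] at hc; omega)
    rw [e, List.mem_toFinset] at hX
    refine ⟨l ++ [X], by simp [hl], ?_, fun j => ?_⟩
    · rw [List.nodup_append]
      refine ⟨hnd, List.nodup_singleton _, ?_⟩
      rintro a ha b hb rfl
      exact hX (List.mem_singleton.1 hb ▸ ha)
    · rcases le_or_gt j i with hj | hj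
      · rw [List.take_append_of_le_length (by omega)]
        exact hF j
      · refine ⟨S, hS, ?_⟩
        rw [List.take_of_length_le (by simp; omega), eS, e]
        ext A
        simp

theorem flag_surjective :
    Function.Surjective (AdmissibleOrder.flag (w := w) (k := k + 1)) := by
  intro F
  obtain ⟨l, hl, hnd, hF⟩ := exists_list_of_flag F _ le_rfl
  have hcons : ∀ i, IsConsistent w (k + 1) (l.take i).toFinset := fun i => by
    obtain ⟨R, -, e⟩ := hF i
    exact e ▸ R.2
  have hsub : l.toFinset ⊆ Inv w (k + 1) := by
    have := (hcons l.length).subset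
    rwa [List.take_length] at this
  have heq : l.toFinset = Inv w (k + 1) :=
    Finset.eq_of_subset_of_card_le hsub (by rw [List.toFinset_card_of_nodup hnd, hl])
  let ρ : AdmissibleOrder w (k + 1) :=
    ⟨l, isAdmissible_of_take hnd (fun X => by rw [← heq, List.mem_toFinset]) hcons⟩
  -- The flag of `ρ` is already maximal, so its containment in `F` suffices.
  refine ⟨ρ, Flag.ext (ρ.flag.max_chain' F.Chain' ?_)⟩
  rintro _ ⟨i, rfl⟩
  obtain ⟨R, hR, e⟩ := hF i
  have : ρ.segment i = R := ConsistentSet.ext e.symm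
  rw [this]
  exact hR

/-- Maximal chains of consistent sets correspond to admissible orders. -/
noncomputable def flagEquiv (w : Equiv.Perm (Fin n)) (k : ℕ) :
    Flag (ConsistentSet w (k + 1)) ≃ AdmissibleOrder w (k + 1) :=
  (Equiv.ofBijective _ ⟨AdmissibleOrder.flag_injective, flag_surjective⟩).symm

theorem flag_flagEquiv (F : Flag (ConsistentSet w (k + 1))) : (flagEquiv w k F).flag = F :=
  Equiv.ofBijective_apply_symm_apply _ _ F

theorem range_segment_fin (ρ : AdmissibleOrder w k) :
    (Set.range fun i : Fin ((Inv w k).card + 1) => ρ.segment i) = Set.range ρ.segment := by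
  ext T
  constructor
  · rintro ⟨i, rfl⟩; exact ⟨i, rfl⟩
  · rintro ⟨i, rfl⟩
    rcases lt_or_ge i ((Inv w k).card + 1) with hi | hi
    · exact ⟨⟨i, hi⟩, rfl⟩
    · exact ⟨⟨(Inv w k).card, by omega⟩, (ρ.segment_eq_of_le (by omega)).symm⟩

theorem map_singleton_eq_ofFn (ρ : AdmissibleOrder w k) :
    ρ.1.map (fun X => ({X} : Finset (Finset (Fin n)))) =
      List.ofFn fun i : Fin (Inv w k).card => (ρ.segment (i + 1)).1 \ (ρ.segment i).1 := by
  refine List.ext_getElem (by simp [ρ.length_eq]) fun i hi hi' => ?_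
  rw [List.length_map] at hi
  obtain ⟨h1, h2⟩ := ρ.segment_add_one hi
  rw [List.getElem_map, List.getElem_ofFn]
  simp only [h2]
  rw [Finset.insert_sdiff_of_notMem _ h1, Finset.sdiff_self, insert_empty_eq]

end HigherBruhat

theorem mainTheorem3 (n k : ℕ) (hn : 0 < n) (hk : 0 < k) (w : Equiv.Perm (Fin n)) :
    -- (a) the poset isomorphism sending a class to the reversal set of its members
    (∀ a b : HigherBruhat.BruhatOrder w k, a ≤ b → b ≤ a → a = b) ∧
    (∃ e : HigherBruhat.BruhatOrder w k ≃o HigherBruhat.ConsistentSet w (k + 1),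
      (∀ ρ : HigherBruhat.AdmissibleOrder w k,
        (e (HigherBruhat.cls w k ρ)).1 = HigherBruhat.Rev w k ρ.1) ∧
      -- (b) for the poset of classes of admissible orders
      (∃ g : GradeMinOrder ℕ (HigherBruhat.BruhatOrder w k), ∀ b, g.grade b = (e b).1.card) ∧
      (∃ m : HigherBruhat.BruhatOrder w k, (e m).1 = ∅ ∧ IsBot m ∧ ∀ b, IsMin b → b = m) ∧
      (∃ m : HigherBruhat.BruhatOrder w k,
        (e m).1 = HigherBruhat.Inv w (k + 1) ∧ IsTop m ∧ ∀ b, IsMax b → b = m)) ∧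
    -- (b) for the poset of consistent sets
    (∃ g : GradeMinOrder ℕ (HigherBruhat.ConsistentSet w (k + 1)),
      ∀ R, g.grade R = R.1.card) ∧
    (∃ m : HigherBruhat.ConsistentSet w (k + 1),
      m.1 = ∅ ∧ IsBot m ∧ ∀ R, IsMin R → R = m) ∧
    (∃ m : HigherBruhat.ConsistentSet w (k + 1),
      m.1 = HigherBruhat.Inv w (k + 1) ∧ IsTop m ∧ ∀ R, IsMax R → R = m) ∧
    -- (c) a maximal chain `∅ = R_0 ⋖ R_1 ⋖ ⋯ ⋖ R_N` goes to `(R_1 \ R_0, …, R_N \ R_{N-1})`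
    (∃ Φ : Flag (HigherBruhat.ConsistentSet w (k + 1)) ≃ HigherBruhat.AdmissibleOrder w (k + 1),
      ∀ F : Flag (HigherBruhat.ConsistentSet w (k + 1)),
        ∃ R : Fin ((HigherBruhat.Inv w (k + 1)).card + 1) →
            HigherBruhat.ConsistentSet w (k + 1),
          Set.range R = (F : Set (HigherBruhat.ConsistentSet w (k + 1))) ∧
          (R 0).1 = ∅ ∧ (∀ i : Fin (HigherBruhat.Inv w (k + 1)).card, R i.castSucc ⋖ R i.succ) ∧
          (Φ F).1.map (fun X => ({X} : Finset (Finset (Fin n)))) =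
            List.ofFn fun i : Fin (HigherBruhat.Inv w (k + 1)).card =>
              (R i.succ).1 \ (R i.castSucc).1) := by
  have he := HigherBruhat.revIso_cls (w := w) hk
  set e := HigherBruhat.revIso w hk
  refine ⟨fun a b hab hba => e.injective (le_antisymm (e.monotone hab) (e.monotone hba)),
    ⟨e, he, ⟨HigherBruhat.gradeBruhat w hk, fun _ => rfl⟩, ?_, ?_⟩,
    ⟨HigherBruhat.gradeConsistent w k, fun _ => rfl⟩,
    ⟨_, rfl, HigherBruhat.empty_le, fun _ => HigherBruhat.eq_empty_of_isMin⟩,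
    ⟨_, rfl, HigherBruhat.le_Inv, fun _ => HigherBruhat.eq_Inv_of_isMax⟩,
    HigherBruhat.flagEquiv w k, fun F => ?_⟩
  · refine ⟨e.symm HigherBruhat.ConsistentSet.empty, ?_, fun b => ?_, fun b hb => ?_⟩
    · rw [e.apply_symm_apply]; rfl
    · rw [e.symm_apply_le]
      exact HigherBruhat.empty_le _
    · rw [e.eq_symm_apply]
      exact HigherBruhat.eq_empty_of_isMin (e.isMin_apply.2 hb)
  · refine ⟨e.symm HigherBruhat.ConsistentSet.full, ?_, fun b => ?_, fun b hb => ?_⟩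
    · rw [e.apply_symm_apply]; rfl
    · rw [e.le_symm_apply]
      exact HigherBruhat.le_Inv _
    · rw [e.eq_symm_apply]
      exact HigherBruhat.eq_Inv_of_isMax (e.isMax_apply.2 hb)
  · refine ⟨fun i => (HigherBruhat.flagEquiv w k F).segment i, ?_, rfl, fun i => ?_, ?_⟩
    · rw [HigherBruhat.range_segment_fin]
      exact congrArg Flag.carrier (HigherBruhat.flag_flagEquiv F)
    · exact ((HigherBruhat.flagEquiv w k F).singleStep_segment i.2).covBy
    · exact HigherBruhat.map_singleton_eq_ofFn _
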